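/- Let $L>0$, $d\in\mathbb N$, let $\mathbb T=\mathbb T_L^d$ be the $d$-dimensional torus of side length $L$, let $\mu\in\mathbb R$, and let $W:\mathbb T\to\mathbb R$ be even and of class $C^2$. For a density $N$ put $w_N=\int_{\mathbb T}W(\cdot-y)N(y)\,dy$, $\Phi_N=\log N-\mu+w_N$ and $$\Omega_N=\frac{N e^{-\frac12(\mu-w_N)}-e^{\frac12(\mu-w_N)}}{\log N-\mu+w_N},$$ with the limiting value $\Omega_N=\sqrt N$ where the denominator vanishes. Let $N_0\in C^1(\mathbb T)$ be bounded below by a positive constant. Then there is $h_0>0$, depending only on $N_0$ and on the parameters $W,\mu,d,L$, such that for every $0<h<h_0$ the following holds. (i) The discrete equation $$\frac{N-N_0}{h}=\nabla\cdot(N_0\nabla\Phi_N)-\Omega_{N_0}\Phi_N\quad\text{on }\mathbb T,$$ understood weakly, i.e. $\int_{\mathbb T}\frac{N-N_0}{h}\psi\,dx=-\int_{\mathbb T}\big(N_0\nabla\Phi_N\cdot\nabla\psi+\Omega_{N_0}\Phi_N\psi\big)dx$ for all $\psi\in C^\infty(\mathbb T)$, has, up to a.e. equality, exactly one solution $N$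 with $N>0$ a.e., $N\in L^1(\mathbb T)$ and $\log N\in H^1(\mathbb T)$. (ii) Consider the JKO-type functional $$\mathbb J_A(N_0,N)=\tfrac12\mathbb D_A^2(N_0,N)+h\,\mathscr G_\mu(N),$$ $$\mathscr G_\mu(N)=\int_{\mathbb T}\big(N\log N-(1+\mu)N\big)dx+\tfrac12\int_{\mathbb T\times\mathbb T}W(x-y)N(x)N(y)\,dx\,dy$$ on the nonnegative functions $N\in L^1(\mathbb T)$ (with $\mathscr G_\mu(N)=+\infty$ if $N\log N\notin L^1$), where $$\mathbb D_A^2(N_0,N)=\inf_\phi\;h\int_0^h\!\int_{\mathbb T}\big(N_0|\nabla\phi|^2+\Omega_{N_0}\phi^2\big)dx\,dt,$$ the infimum being over all fields $\phi\in L^2((0,h);H^1(\mathbb T))$ such that the (weak) evolution $\partial_tN_t=\nabla\cdot(N_0\nabla\phi)-\Omega_{N_0}\phi$ started at $N_0$ at $t=0$ arrives at $N$ at $t=h$ ($\inf\emptyset=+\infty$). Up to a.e. equality, $\mathbb J_A(N_0,\cdot)$ has exactly one minimizer, namely the solution $N$ of (i). -/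

import Mathlib

open MeasureTheory

noncomputable section

namespace GrandCanonical

/-- The `d`-dimensional torus of side length `L`. Its `volume` is Lebesgue measure (of total
mass `L ^ d`). -/
abbrev Torus (L : ℝ) (d : ℕ) : Type := Fin d → AddCircle L

variable {L : ℝ} [Fact (0 < L)] {d : ℕ}

/-- `f` is of class `C^n` on the torus: its periodic lift to `ℝ^d` is of class `C^n`. -/
def IsCk (n : WithTop ℕ∞) (f : Torus L d → ℝ) : Prop :=
  ContDiff ℝ n (fun x : Fin d → ℝ => f (fun i => (x i : AddCircle L)))

/-- Test functions: the smooth functions on the torus. -/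
def IsTest (ψ : Torus L d → ℝ) : Prop := IsCk ((⊤ : ℕ∞) : WithTop ℕ∞) ψ

/-- The classical partial derivative in the `i`-th coordinate direction. -/
def pderiv (i : Fin d) (f : Torus L d → ℝ) (x : Torus L d) : ℝ :=
  deriv (fun t : ℝ => f (x + Pi.single i (t : AddCircle L))) 0

/-- `f` belongs to the Sobolev space `H^1` of the torus and `g` is its weak gradient. -/
structure HasH1Grad (f : Torus L d → ℝ) (g : Fin d → Torus L d → ℝ) : Prop where
  memLp : MemLp f 2 volume
  memLp_grad : ∀ i, MemLp (g i) 2 volume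
  weak : ∀ (i : Fin d) (ψ : Torus L d → ℝ), IsTest ψ →
    ∫ x, f x * pderiv i ψ x = - ∫ x, g i x * ψ x

/-- The Sobolev space `H^1` of the torus. -/
def MemH1 (f : Torus L d → ℝ) : Prop := ∃ g, HasH1Grad f g

/-- `w_N = W * N`. -/
def wConv (W N : Torus L d → ℝ) (x : Torus L d) : ℝ := ∫ y, W (x - y) * N y

/-- `Φ_N = log N - μ + w_N`. -/
def Phi (W : Torus L d → ℝ) (μ : ℝ) (N : Torus L d → ℝ) (x : Torus L d) : ℝ :=
  Real.log (N x) - μ + wConv W N x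

open Classical in
/-- `Ω_N = (N exp (-(μ - w_N) / 2) - exp ((μ - w_N) / 2)) / (log N - μ + w_N)`. The numerator equals
`2 √N sinh (Φ_N / 2)`, so the limiting value where the denominator `Φ_N` vanishes is `√N`. -/
def Omega (W : Torus L d → ℝ) (μ : ℝ) (N : Torus L d → ℝ) (x : Torus L d) : ℝ :=
  if Phi W μ N x = 0 then Real.sqrt (N x)
  else (N x * Real.exp (-(1 / 2) * (μ - wConv W N x)) - Real.exp ((1 / 2) * (μ - wConv W N x)))
    / Phi W μ N x

/-- The integrand `N₀ ∇φ·∇ψ + Ω_{N₀} φ ψ` of the weighted inner product attached to `N₀`, where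
`g` and `k` are the gradients of `φ` and `ψ`. -/
def energyDensity (W : Torus L d → ℝ) (μ : ℝ) (N₀ : Torus L d → ℝ)
    (φ : Torus L d → ℝ) (g : Fin d → Torus L d → ℝ)
    (ψ : Torus L d → ℝ) (k : Fin d → Torus L d → ℝ) (x : Torus L d) : ℝ :=
  N₀ x * ∑ i, g i x * k i x + Omega W μ N₀ x * φ x * ψ x

/-- The discrete equation `(N - N₀) / h = ∇·(N₀ ∇Φ_N) - Ω_{N₀} Φ_N`, in the weak sense. -/
def SolvesDiscrete (W : Torus L d → ℝ) (μ : ℝ) (N₀ : Torus L d → ℝ) (h : ℝ)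
    (N : Torus L d → ℝ) : Prop :=
  ∃ g : Fin d → Torus L d → ℝ, HasH1Grad (Phi W μ N) g ∧
    ∀ ψ : Torus L d → ℝ, IsTest ψ →
      ∫ x, (N x - N₀ x) / h * ψ x =
        - ∫ x, energyDensity W μ N₀ (Phi W μ N) g ψ (fun i => pderiv i ψ) x

/-- `N` is a (positive) solution of the discrete equation with `N ∈ L^1` and `log N ∈ H^1`. -/
structure IsSolution (W : Torus L d → ℝ) (μ : ℝ) (N₀ : Torus L d → ℝ) (h : ℝ)
    (N : Torus L d → ℝ) : Prop where
  integrable : Integrable N volume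
  pos : ∀ᵐ x, 0 < N x
  log_memH1 : MemH1 (fun x => Real.log (N x))
  eqn : SolvesDiscrete W μ N₀ h N

/-- The time-dependent field `φ t` (with spatial weak gradient `g t`), `0 < t < h`, drives `N₀` at
time `0` to `N` at time `h` under the linearized dynamics `∂ₜ N_t = ∇·(N₀ ∇φ_t) - Ω_{N₀} φ_t`.
The last field is this evolution equation tested against `ψ` and integrated over `0 < t < h`
(integrated up to an earlier time, the same formula determines the intermediate `N_t`). -/
structure Drives (W : Torus L d → ℝ) (μ : ℝ) (N₀ : Torus L d → ℝ) (h : ℝ) (N : Torus L d → ℝ)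
    (φ : ℝ → Torus L d → ℝ) (g : ℝ → Fin d → Torus L d → ℝ) : Prop where
  memLp : MemLp (fun p : ℝ × Torus L d => φ p.1 p.2) 2
    ((volume.restrict (Set.Ioo 0 h)).prod volume)
  memLp_grad : ∀ i, MemLp (fun p : ℝ × Torus L d => g p.1 i p.2) 2
    ((volume.restrict (Set.Ioo 0 h)).prod volume)
  hasGrad : ∀ᵐ t ∂(volume.restrict (Set.Ioo 0 h)), HasH1Grad (φ t) (g t)
  arrives : ∀ ψ : Torus L d → ℝ, IsTest ψ →
    ∫ x, (N x - N₀ x) * ψ x =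
      - ∫ t in Set.Ioo 0 h, ∫ x, energyDensity W μ N₀ (φ t) (g t) ψ (fun i => pderiv i ψ) x

/-- The squared approximate distance: the infimum over the driving fields `φ` from `N₀` to `N` of
`h ∫₀ʰ ∫ (N₀ |∇φ|² + Ω_{N₀} φ²) dx dt` (and `∞` if there is no driving field). -/
def distASq (W : Torus L d → ℝ) (μ : ℝ) (N₀ : Torus L d → ℝ) (h : ℝ) (N : Torus L d → ℝ) :
    ENNReal :=
  ⨅ (φ : ℝ → Torus L d → ℝ) (g : ℝ → Fin d → Torus L d → ℝ) (_ : Drives W μ N₀ h N φ g),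
    ENNReal.ofReal h * ∫⁻ t in Set.Ioo 0 h, ∫⁻ x,
      ENNReal.ofReal (energyDensity W μ N₀ (φ t) (g t) (φ t) (g t) x)

/-- Densities: nonnegative integrable functions. -/
def IsDensity (N : Torus L d → ℝ) : Prop := Integrable N volume ∧ ∀ᵐ x, 0 ≤ N x

open Classical in
/-- The grand canonical free energy
`∫ (N log N - (N + μ N)) dx + 1/2 ∫∫ W (x - y) N x N y dx dy` of a density. As `N log N ≥ -1/e`,
it is `+∞` exactly when `N log N` is not integrable (for bounded `W`). -/
def freeEnergy (W : Torus L d → ℝ) (μ : ℝ) (N : Torus L d → ℝ) : EReal :=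
  if Integrable (fun x => N x * Real.log (N x)) volume then
    (((∫ x, (N x * Real.log (N x) - (N x + μ * N x)))
      + (1 / 2) * ∫ x, ∫ y, W (x - y) * N x * N y : ℝ) : EReal)
  else ⊤

/-- The functional `J_A(N₀, N) = 1/2 D_A²(N₀, N) + h G_μ(N)`. -/
def jkoFunctional (W : Torus L d → ℝ) (μ : ℝ) (N₀ : Torus L d → ℝ) (h : ℝ)
    (N : Torus L d → ℝ) : EReal :=
  ((distASq W μ N₀ h N / 2 : ENNReal) : EReal) + (h : EReal) * freeEnergy W μ N

/-- `N` minimizes `J_A(N₀, ·)` among all densities. -/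
def IsJKOMinimizer (W : Torus L d → ℝ) (μ : ℝ) (N₀ : Torus L d → ℝ) (h : ℝ)
    (N : Torus L d → ℝ) : Prop :=
  IsDensity N ∧ ∀ M : Torus L d → ℝ, IsDensity M →
    jkoFunctional W μ N₀ h N ≤ jkoFunctional W μ N₀ h M

end GrandCanonical

end

noncomputable section

set_option linter.unusedSectionVars false

open scoped RealInnerProductSpace
open Filter Topology


namespace GrandCanonical

/-! ### Calculus of `C^k` functions on the torus. -/

variable {L : ℝ} [Fact (0 < L)] {d : ℕ}

/-! Put on `H^1` the inner product `∫ (N₀ ∇φ·∇ψ + Ω_{N₀} φ ψ)`; the weights lie between positive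
constants, so it is equivalent to the usual one. Let `B` be its Riesz map into the dual. The
discrete equation is `N - N₀ = -h B Φ_N`. The weighted jet `(√Ω φ, √N₀ ∇φ)` turns this inner product
into that of a product of `L²` spaces, and `Represents` says that an `L¹` function acts on test
functions as the pairing with a jet.

Existence. With `N = e^φ` and the interaction potential frozen at `w`, the equation reads `e^φ + h B
φ = h B a`, where `a` is built from `μ`, `N₀` and `w`. This is the Euler–Lagrange equation of the
strongly convex functional `∫ e^φ + (h/2) ‖φ - a‖²`, whose minimizer is a Lipschitz function of `a`
(`exists_solution_operator`). Because `W` is `C²`, convolution with `W` is bounded from the dual of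
`H^1` to `H^1` (`norm_convJet_le`). The difference of two densities `e^φ` is `h B` of something
Lipschitz in `w`, so `w ↦ W * e^φ` is a contraction for small `h` (`exists_represents`).

Minimality. By Jensen's inequality in time a driving field may be replaced by its time average `ζ`,
with `M - N₀ = -h B ζ` and `h² ‖ζ‖²` at most the cost; conversely, for a solution the constant field
`Φ_N` is admissible. Write `X` for the jet of `Φ_N`. Expanding the free energy at `N` gives a
first-order term `∫ (M - N) Φ_N = h ⟪X - ζ, X⟫`, a relative entropy, and the quadratic interaction
of `M - N`. The first-order term completes the square in the distance to `(h²/2) ‖X - ζ‖²`, which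
absorbs the possibly negative interaction when `h A ≤ 1`. What remains is `J(M) ≥ J(N) + h ∫
relEntropy(M, N)` (`energy_gap`). Hence every solution is the unique minimizer, and so solutions are
unique as well.

The delicate point is that densities are only in `L¹` while `Φ_N` is only in `H^1`, so `∫ (M - N)
Φ_N` has no a priori meaning. A Brezis–Browder type argument (`Represents.integral_mul`) settles it:
if `u ∈ L¹` represents a functional on `H^1`, `v ∈ H^1`, and `u v` is bounded above by an integrable
function, then `u v` is integrable and its integral is the value of the functional. It relies on the
density of test functions in `H^1`, which follows from the completeness of the characters. -/

/-- The covering map `ℝ^d → 𝕋`. -/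
def cover (x : Fin d → ℝ) : Torus L d := fun i => (x i : AddCircle L)

lemma isOpenQuotientMap_cover : IsOpenQuotientMap (cover (L := L) (d := d)) :=
  IsOpenQuotientMap.piMap fun _ => QuotientAddGroup.isOpenQuotientMap_mk

lemma cover_surjective : Function.Surjective (cover (L := L) (d := d)) :=
  isOpenQuotientMap_cover.surjective

lemma cover_add (x y : Fin d → ℝ) :
    (cover (x + y) : Torus L d) = cover x + cover y := by
  ext i; simp [cover]

lemma cover_neg (x : Fin d → ℝ) : (cover (-x) : Torus L d) = -cover x := by
  ext i; simp [cover]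

lemma cover_smul_single (i : Fin d) (t : ℝ) :
    (cover (t • Pi.single i 1) : Torus L d) = Pi.single i (t : AddCircle L) := by
  ext j
  by_cases h : j = i
  · subst h; simp [cover]
  · simp [cover, h]

lemma isCk_iff {n : WithTop ℕ∞} {f : Torus L d → ℝ} :
    IsCk n f ↔ ContDiff ℝ n (f ∘ cover) := Iff.rfl

lemma IsCk.continuous {n : WithTop ℕ∞} {f : Torus L d → ℝ} (hf : IsCk n f) : Continuous f :=
  isOpenQuotientMap_cover.isQuotientMap.continuous_iff.2 (isCk_iff.1 hf).continuous

lemma IsCk.of_le {m n : WithTop ℕ∞} {f : Torus L d → ℝ} (hf : IsCk n f) (h : m ≤ n) :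
    IsCk m f := ContDiff.of_le hf h

lemma line_cover (f : Torus L d → ℝ) (i : Fin d) (x : Fin d → ℝ) (t : ℝ) :
    f (cover x + Pi.single i (t : AddCircle L)) = (f ∘ cover) (x + t • Pi.single i 1) := by
  simp [cover_add, cover_smul_single]

lemma hasDerivAt_line {f : (Fin d → ℝ) → ℝ} (hf : Differentiable ℝ f) (x v : Fin d → ℝ) (s : ℝ) :
    HasDerivAt (fun t : ℝ => f (x + t • v)) (fderiv ℝ f (x + s • v) v) s := by
  have h1 : HasDerivAt (fun t : ℝ => x + t • v) v s := by
    simpa using ((hasDerivAt_id s).smul_const v).const_add x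
  exact (hf (x + s • v)).hasFDerivAt.comp_hasDerivAt s h1

lemma IsCk.pderiv_cover {f : Torus L d → ℝ} (hf : IsCk 1 f) (i : Fin d) (x : Fin d → ℝ) :
    pderiv i f (cover x) = fderiv ℝ (f ∘ cover) x (Pi.single i 1) := by
  have h := hasDerivAt_line ((isCk_iff.1 hf).differentiable one_ne_zero) x (Pi.single i 1) 0
  unfold pderiv
  simp_rw [line_cover]
  simpa using h.deriv

lemma IsCk.hasDerivAt {f : Torus L d → ℝ} (hf : IsCk 1 f) (i : Fin d) (x : Torus L d) (s : ℝ) :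
    HasDerivAt (fun t : ℝ => f (x + Pi.single i (t : AddCircle L)))
      (pderiv i f (x + Pi.single i (s : AddCircle L))) s := by
  obtain ⟨x, rfl⟩ := cover_surjective x
  have h := hasDerivAt_line ((isCk_iff.1 hf).differentiable one_ne_zero) x (Pi.single i 1) s
  rw [← hf.pderiv_cover, cover_add, cover_smul_single] at h
  simpa only [line_cover] using h

lemma IsCk.pderiv {m n : WithTop ℕ∞} {f : Torus L d → ℝ} (hf : IsCk n f) (h : m + 1 ≤ n)
    (i : Fin d) : IsCk m (pderiv i f) := by
  have h1 : IsCk 1 f := hf.of_le (le_trans (by simp) h)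
  have : (GrandCanonical.pderiv i f) ∘ cover =
      fun x => fderiv ℝ (f ∘ cover) x (Pi.single i 1) := by
    ext x; exact h1.pderiv_cover i x
  rw [isCk_iff, this]
  exact ((isCk_iff.1 hf).fderiv_right h).clm_apply contDiff_const

lemma IsTest.pderiv {f : Torus L d → ℝ} (hf : IsTest f) (i : Fin d) :
    IsTest (pderiv i f) := IsCk.pderiv (n := ((⊤ : ℕ∞) : WithTop ℕ∞)) hf (by simp) i

lemma IsTest.isCk {f : Torus L d → ℝ} (hf : IsTest f) : IsCk 1 f :=
  IsCk.of_le (n := ((⊤ : ℕ∞) : WithTop ℕ∞)) hf (by exact_mod_cast le_top)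

lemma IsCk.hasDerivAt_zero {f : Torus L d → ℝ} (hf : IsCk 1 f) (i : Fin d) (x : Torus L d) :
    HasDerivAt (fun t : ℝ => f (x + Pi.single i (t : AddCircle L))) (GrandCanonical.pderiv i f x) 0 := by
  simpa using hf.hasDerivAt i x 0

lemma IsCk.mul {n : WithTop ℕ∞} {f g : Torus L d → ℝ} (hf : IsCk n f) (hg : IsCk n g) :
    IsCk n (fun x => f x * g x) := ContDiff.mul hf hg

lemma IsCk.add {n : WithTop ℕ∞} {f g : Torus L d → ℝ} (hf : IsCk n f) (hg : IsCk n g) :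
    IsCk n (fun x => f x + g x) := ContDiff.add hf hg

lemma IsCk.const_mul {n : WithTop ℕ∞} {f : Torus L d → ℝ} (c : ℝ) (hf : IsCk n f) :
    IsCk n (fun x => c * f x) := ContDiff.mul contDiff_const hf

lemma isCk_const {n : WithTop ℕ∞} (c : ℝ) : IsCk n (fun _ : Torus L d => c) := contDiff_const

lemma IsCk.comp {n : WithTop ℕ∞} {f : Torus L d → ℝ} {T : ℝ → ℝ} (hT : ContDiff ℝ n T)
    (hf : IsCk n f) : IsCk n (fun x => T (f x)) := hT.comp (isCk_iff.1 hf)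

lemma IsCk.comp_sub {n : WithTop ℕ∞} {f : Torus L d → ℝ} (hf : IsCk n f) (x : Torus L d) :
    IsCk n (fun y => f (x - y)) := by
  obtain ⟨x, rfl⟩ := cover_surjective x
  have : (fun y => f (cover x - y)) ∘ cover = (f ∘ cover) ∘ fun y => x - y := by
    ext y; simp [sub_eq_add_neg, cover_add, cover_neg]
  rw [isCk_iff, this]
  exact (isCk_iff.1 hf).comp (contDiff_const.sub contDiff_id)

lemma pderiv_mul {f g : Torus L d → ℝ} (hf : IsCk 1 f) (hg : IsCk 1 g) (i : Fin d)
    (x : Torus L d) :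
    pderiv i (fun y => f y * g y) x = pderiv i f x * g x + f x * pderiv i g x := by
  have h := ((hf.hasDerivAt_zero i x).fun_mul (hg.hasDerivAt_zero i x)).deriv
  rw [AddCircle.coe_zero, Pi.single_zero, add_zero] at h
  exact h

lemma pderiv_add {f g : Torus L d → ℝ} (hf : IsCk 1 f) (hg : IsCk 1 g) (i : Fin d)
    (x : Torus L d) :
    pderiv i (fun y => f y + g y) x = pderiv i f x + pderiv i g x :=
  ((hf.hasDerivAt_zero i x).add (hg.hasDerivAt_zero i x)).deriv

lemma pderiv_const_mul {f : Torus L d → ℝ} (c : ℝ) (hf : IsCk 1 f) (i : Fin d)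
    (x : Torus L d) : pderiv i (fun y => c * f y) x = c * pderiv i f x :=
  ((hf.hasDerivAt_zero i x).const_mul c).deriv

lemma pderiv_const (c : ℝ) (i : Fin d) (x : Torus L d) :
    pderiv i (fun _ => c) x = 0 := by
  simp [pderiv]

lemma pderiv_comp {f : Torus L d → ℝ} {T : ℝ → ℝ} (hT : Differentiable ℝ T) (hf : IsCk 1 f)
    (i : Fin d) (x : Torus L d) :
    pderiv i (fun y => T (f y)) x = deriv T (f x) * pderiv i f x := by
  have h := (hT (f (x + Pi.single i ((0 : ℝ) : AddCircle L)))).hasDerivAt.comp 0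
    (hf.hasDerivAt_zero i x)
  simpa [pderiv, Function.comp_def] using h.deriv

lemma pderiv_comp_sub {f : Torus L d → ℝ} (hf : IsCk 1 f) (i : Fin d) (x y : Torus L d) :
    pderiv i (fun z => f (x - z)) y = - pderiv i f (x - y) := by
  have h := hf.hasDerivAt i (x - y) (-(0 : ℝ))
  have h2 := h.comp (0 : ℝ) (hasDerivAt_neg 0)
  have h3 : (fun t : ℝ => f (x - (y + Pi.single i (t : AddCircle L)))) =
      (fun t : ℝ => f (x - y + Pi.single i (t : AddCircle L))) ∘ Neg.neg := by
    ext t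
    simp only [Function.comp, AddCircle.coe_neg, Pi.single_neg]
    congr 1; abel
  unfold pderiv
  rw [h3, h2.deriv]
  simp [pderiv]

lemma exists_bound {f : Torus L d → ℝ} (hf : Continuous f) : ∃ K : ℝ, 0 ≤ K ∧ ∀ x, |f x| ≤ K := by
  obtain ⟨K, hK⟩ := isCompact_univ.exists_bound_of_continuousOn (f := f) hf.continuousOn
  exact ⟨K, (norm_nonneg _).trans (hK 0 trivial), fun x => hK x trivial⟩

lemma memLp_of_continuous {f : Torus L d → ℝ} (hf : Continuous f) (p : ENNReal) :
    MemLp f p (volume : Measure (Torus L d)) := by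
  obtain ⟨K, -, hK⟩ := exists_bound hf
  exact MemLp.of_bound hf.aestronglyMeasurable K (ae_of_all _ hK)

lemma integrable_of_continuous {f : Torus L d → ℝ} (hf : Continuous f) :
    Integrable f (volume : Measure (Torus L d)) :=
  memLp_one_iff_integrable.1 (memLp_of_continuous hf 1)

lemma hasDerivAt_integral_of_bound {α : Type*} [MeasurableSpace α] {μ : Measure α}
    [IsFiniteMeasure μ] {F F' : ℝ → α → ℝ} {K : ℝ} (hm : ∀ t, AEStronglyMeasurable (F t) μ)
    (hi : Integrable (F 0) μ) (hm' : AEStronglyMeasurable (F' 0) μ) (hb : ∀ x t, |F' t x| ≤ K)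
    (hd : ∀ x t, HasDerivAt (fun t => F t x) (F' t x) t) :
    HasDerivAt (fun t => ∫ x, F t x ∂μ) (∫ x, F' 0 x ∂μ) 0 :=
  (hasDerivAt_integral_of_dominated_loc_of_deriv_le (s := Set.univ) (bound := fun _ => K)
    Filter.univ_mem (Filter.Eventually.of_forall hm) hi hm' (ae_of_all _ fun x t _ => hb x t)
    (integrable_const K) (ae_of_all _ fun x t _ => hd x t)).2

/-- The integral of a translate does not depend on the translation, so differentiating under the
integral sign yields the derivative of a constant. This is the source of integration by parts on the
torus. -/
lemma integral_eq_zero_of_hasDerivAt_translate {f f' : Torus L d → ℝ} (hf : Continuous f)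
    (hf' : Continuous f') (e : ℝ → Torus L d)
    (hd : ∀ x t, HasDerivAt (fun s => f (x + e s)) (f' (x + e t)) t) : ∫ x, f' x = 0 := by
  obtain ⟨K, -, hK⟩ := exists_bound hf'
  have hadd (t : ℝ) : Continuous fun x : Torus L d => x + e t := continuous_id.add continuous_const
  have h := hasDerivAt_integral_of_bound (μ := (volume : Measure (Torus L d)))
    (F := fun t x => f (x + e t)) (F' := fun t x => f' (x + e t)) (K := K)
    (fun t => (hf.comp (hadd t)).aestronglyMeasurable)
    (integrable_of_continuous (hf.comp (hadd 0)))
    (hf'.comp (hadd 0)).aestronglyMeasurable (fun x t => hK _) hd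
  simp only [fun t => integral_add_right_eq_self (μ := volume) f (e t),
    integral_add_right_eq_self (μ := volume) f' (e 0)] at h
  exact h.unique (hasDerivAt_const _ _)

lemma integral_pderiv {f : Torus L d → ℝ} (hf : IsCk 1 f) (i : Fin d) :
    ∫ x, pderiv i f x = 0 :=
  integral_eq_zero_of_hasDerivAt_translate hf.continuous
    (hf.pderiv (m := 0) (by simp) i).continuous (fun t => Pi.single i (t : AddCircle L))
    fun x t => hf.hasDerivAt i x t

lemma integral_mul_pderiv {f g : Torus L d → ℝ} (hf : IsCk 1 f) (hg : IsCk 1 g) (i : Fin d) :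
    ∫ x, f x * pderiv i g x = - ∫ x, pderiv i f x * g x := by
  have h := integral_pderiv (hf.mul hg) i
  simp_rw [pderiv_mul hf hg] at h
  have hcf : Continuous (pderiv i f) := (hf.pderiv (m := 0) (by simp) i).continuous
  have hcg : Continuous (pderiv i g) := (hg.pderiv (m := 0) (by simp) i).continuous
  rw [integral_add (f := fun x => pderiv i f x * g x) (g := fun x => f x * pderiv i g x)
    (integrable_of_continuous (hcf.mul hg.continuous))
    (integrable_of_continuous (hf.continuous.mul hcg))] at h
  linarith

lemma IsCk.continuous_pderiv {f : Torus L d → ℝ} (hf : IsCk 1 f) (i : Fin d) :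
    Continuous (GrandCanonical.pderiv i f) := (hf.pderiv (m := 0) (by simp) i).continuous

lemma IsCk.hasH1Grad {f : Torus L d → ℝ} (hf : IsCk 1 f) :
    HasH1Grad f (fun i => GrandCanonical.pderiv i f) where
  memLp := memLp_of_continuous hf.continuous 2
  memLp_grad i := memLp_of_continuous (hf.continuous_pderiv i) 2
  weak i _ hψ := integral_mul_pderiv hf hψ.isCk i

/-! ### Convolution of a smooth kernel with an integrable function. -/

lemma integrable_kernel_mul {K u : Torus L d → ℝ} (hK : Continuous K) (hu : Integrable u)
    (x : Torus L d) : Integrable (fun y => K (x - y) * u y) := by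
  obtain ⟨C, -, hC⟩ := exists_bound hK
  exact hu.bdd_mul (c := C) (hK.comp (continuous_const.sub continuous_id)).aestronglyMeasurable
    (ae_of_all _ fun y => hC _)

lemma wConv_sub {K u v : Torus L d → ℝ} (hK : Continuous K) (hu : Integrable u)
    (hv : Integrable v) (x : Torus L d) :
    wConv K (fun x => u x - v x) x = wConv K u x - wConv K v x := by
  unfold wConv
  rw [← integral_sub (integrable_kernel_mul hK hu x) (integrable_kernel_mul hK hv x)]
  congr 1; ext y; ring

lemma continuous_wConv {K u : Torus L d → ℝ} (hK : Continuous K) (hu : Integrable u) :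
    Continuous (wConv K u) := by
  obtain ⟨C, -, hC⟩ := exists_bound hK
  refine continuous_of_dominated (bound := fun y => C * |u y|)
    (fun x => (integrable_kernel_mul hK hu x).aestronglyMeasurable) ?_ (hu.abs.const_mul C) ?_
  · refine fun x => ae_of_all _ fun y => ?_
    rw [Real.norm_eq_abs, abs_mul]
    exact mul_le_mul_of_nonneg_right (hC _) (abs_nonneg _)
  · exact ae_of_all _ fun y => (hK.comp (continuous_id.sub continuous_const)).mul continuous_const

/-- Fubini for the pairing of a convolution with a bounded function. -/
lemma integral_wConv_mul {K u v : Torus L d → ℝ} (hK : Continuous K) (hu : Integrable u)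
    (hv : Integrable v) :
    ∫ x, wConv K u x * v x = ∫ y, (∫ x, K (x - y) * v x) * u y := by
  obtain ⟨C, -, hC⟩ := exists_bound hK
  have hint : Integrable (fun p : Torus L d × Torus L d => K (p.1 - p.2) * (v p.1 * u p.2))
      (volume.prod volume) :=
    (hv.mul_prod hu).bdd_mul (c := C)
      (hK.comp (continuous_fst.sub continuous_snd)).aestronglyMeasurable (ae_of_all _ fun p => hC _)
  have := integral_integral_swap (f := fun x y => K (x - y) * (v x * u y)) hint
  calc ∫ x, wConv K u x * v x = ∫ x, ∫ y, K (x - y) * (v x * u y) := by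
        congr 1; ext x; unfold wConv
        rw [← integral_mul_const]
        congr 1; ext y; ring
    _ = ∫ y, ∫ x, K (x - y) * (v x * u y) := this
    _ = _ := by
        congr 1; ext y
        rw [← integral_mul_const]
        congr 1; ext x; ring

lemma integral_kernel_mul_pderiv {W ψ : Torus L d → ℝ} (hW : IsCk 1 W) (hψ : IsCk 1 ψ)
    (i : Fin d) (y : Torus L d) :
    ∫ x, W (x - y) * pderiv i ψ x = - ∫ x, pderiv i W (x - y) * ψ x := by
  have h1 : IsCk 1 (fun x => W (x - y)) := by
    -- The translate `x ↦ W (x - y)` is written as two reflections, since `comp_sub` treats only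
    -- maps of the form `z ↦ f (x - z)`.
    have := (hW.comp_sub 0).comp_sub y
    simpa using this
  rw [integral_mul_pderiv h1 hψ]
  congr 2; ext x; congr 1
  have := pderiv_comp_sub (hW.comp_sub 0) i y x
  simp only [zero_sub, neg_sub] at this
  rw [this]
  have := pderiv_comp_sub hW i 0 (y - x)
  simp only [zero_sub, neg_sub] at this
  rw [this, neg_neg]

/-- Fubini moves the derivative of the test function onto the kernel, so `u` needs no regularity
beyond integrability. -/
lemma hasH1Grad_wConv {W u : Torus L d → ℝ} (hW : IsCk 1 W) (hu : Integrable u) :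
    HasH1Grad (wConv W u) (fun i => wConv (pderiv i W) u) where
  memLp := memLp_of_continuous (continuous_wConv hW.continuous hu) 2
  memLp_grad i := memLp_of_continuous (continuous_wConv (hW.continuous_pderiv i) hu) 2
  weak i ψ hψ := by
    rw [integral_wConv_mul hW.continuous hu (integrable_of_continuous (hψ.isCk.continuous_pderiv i)),
      integral_wConv_mul (hW.continuous_pderiv i) hu (integrable_of_continuous hψ.continuous),
      ← integral_neg]
    congr 1; ext y
    rw [integral_kernel_mul_pderiv hW hψ.isCk]; ring

/-! ### Characters and their completeness in `L²`. -/

/-- Characters of the torus. -/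
def torusChar (n : Fin d → ℤ) : C(Torus L d, ℂ) where
  toFun x := ∏ i, fourier (n i) (x i)
  continuous_toFun := by fun_prop

lemma torusChar_apply (n : Fin d → ℤ) (x : Torus L d) :
    torusChar n x = ∏ i, fourier (n i) (x i) := rfl

lemma torusChar_add (m n : Fin d → ℤ) (x : Torus L d) :
    torusChar (m + n) x = torusChar m x * torusChar n x := by
  simp only [torusChar_apply, Pi.add_apply, fourier_add, Finset.prod_mul_distrib]

lemma torusChar_neg (n : Fin d → ℤ) (x : Torus L d) :
    torusChar (-n) x = star (torusChar n x) := by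
  simp only [torusChar_apply, Pi.neg_apply, fourier_neg, star_prod]
  rfl

lemma torusChar_apply_add (n : Fin d → ℤ) (x y : Torus L d) :
    torusChar n (x + y) = torusChar n x * torusChar n y := by
  simp only [torusChar_apply, Pi.add_apply, ← Finset.prod_mul_distrib]
  refine Finset.prod_congr rfl fun i _ => ?_
  simp [fourier_apply, smul_add, AddCircle.toCircle_add]

lemma torusChar_single (n : Fin d → ℤ) (i : Fin d) (t : AddCircle L) :
    torusChar n (Pi.single i t : Torus L d) = fourier (n i) t := by
  rw [torusChar_apply, Finset.prod_eq_single i]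
  · simp
  · intro j _ hj
    simp [hj]
  · simp

lemma torusChar_single_one (i : Fin d) (x : Torus L d) :
    torusChar (Pi.single i 1) x = fourier 1 (x i) := by
  rw [torusChar_apply, Finset.prod_eq_single i]
  · simp
  · intro j _ hj
    simp [hj]
  · simp

variable (L d) in
/-- The star subalgebra generated by the characters. -/
def charSubalgebra : StarSubalgebra ℂ C(Torus L d, ℂ) where
  toSubalgebra := Algebra.adjoin ℂ (Set.range torusChar)
  star_mem' := by
    change Algebra.adjoin ℂ (Set.range torusChar) ≤ star (Algebra.adjoin ℂ (Set.range torusChar))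
    refine Algebra.adjoin_le ?_
    rintro _ ⟨n, rfl⟩
    refine Algebra.subset_adjoin ⟨-n, ?_⟩
    ext1 x
    simp only [torusChar_neg, ContinuousMap.star_apply]

lemma charSubalgebra_coe :
    (charSubalgebra L d).toSubalgebra.toSubmodule = Submodule.span ℂ (Set.range torusChar) := by
  apply Algebra.adjoin_eq_span_of_subset
  refine .trans (fun x ↦ Submonoid.closure_induction (fun _ ↦ id) ⟨0, ?_⟩ ?_) Submodule.subset_span
  · ext z
    simp [torusChar_apply]
  · rintro _ _ _ _ ⟨m, rfl⟩ ⟨n, rfl⟩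
    exact ⟨m + n, by ext z; simp [torusChar_add]⟩

lemma charSubalgebra_separatesPoints : (charSubalgebra L d).SeparatesPoints := by
  intro x y hxy
  rw [Ne, funext_iff, not_forall] at hxy
  obtain ⟨i, hi⟩ := hxy
  refine ⟨_, ⟨torusChar (Pi.single i 1), Algebra.subset_adjoin ⟨Pi.single i 1, rfl⟩, rfl⟩, ?_⟩
  dsimp only
  rw [torusChar_single_one, torusChar_single_one, fourier_one, fourier_one]
  contrapose hi
  exact AddCircle.injective_toCircle (Fact.out : 0 < L).ne' (Circle.ext hi)

lemma span_torusChar_closure_eq_top :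
    (Submodule.span ℂ (Set.range (torusChar (L := L) (d := d)))).topologicalClosure = ⊤ := by
  rw [← charSubalgebra_coe]
  exact congr_arg (Subalgebra.toSubmodule <| StarSubalgebra.toSubalgebra ·)
    (ContinuousMap.starSubalgebra_topologicalClosure_eq_top_of_separatesPoints _
      charSubalgebra_separatesPoints)

/-- Real trigonometric monomials. -/
def trig (c : ℂ) (n : Fin d → ℤ) (x : Torus L d) : ℝ := (c * torusChar n x).re

lemma isTest_trig (c : ℂ) (n : Fin d → ℤ) : IsTest (trig c n : Torus L d → ℝ) := by
  have h : ContDiff ℝ ((⊤ : ℕ∞) : WithTop ℕ∞)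
      fun x : Fin d → ℝ => c * ∏ i, Complex.exp (2 * Real.pi * Complex.I * n i * x i / L) := by
    refine contDiff_const.mul (contDiff_prod fun i _ => ?_)
    refine ContDiff.cexp ?_
    have : ContDiff ℝ ((⊤ : ℕ∞) : WithTop ℕ∞) fun x : Fin d → ℝ => ((x i : ℝ) : ℂ) :=
      Complex.ofRealCLM.contDiff.comp (contDiff_apply ℝ ℝ i)
    exact (contDiff_const.mul this).div_const _
  have h2 := Complex.reCLM.contDiff.comp h
  unfold IsTest IsCk
  convert h2 using 1
  ext x
  simp [trig, torusChar_apply]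

lemma pderiv_trig (c : ℂ) (n : Fin d → ℤ) (i : Fin d) :
    pderiv i (trig c n : Torus L d → ℝ) = trig (2 * Real.pi * Complex.I * n i / L * c) n := by
  ext x
  have h0 : HasDerivAt (fun t : ℝ => fourier (n i) (t : AddCircle L))
      (2 * Real.pi * Complex.I * n i / L * fourier (n i) ((0 : ℝ) : AddCircle L)) 0 :=
    hasDerivAt_fourier L (n i) 0
  have h1 := Complex.reCLM.hasFDerivAt.comp_hasDerivAt 0 (h0.const_mul (c * torusChar n x))
  have h2 : (fun t : ℝ => trig c n (x + Pi.single i (t : AddCircle L))) =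
      Complex.reCLM ∘ fun t : ℝ => c * torusChar n x * fourier (n i) (t : AddCircle L) := by
    ext t
    simp only [trig, torusChar_apply_add, torusChar_single, Function.comp, Complex.reCLM_apply,
      mul_assoc]
  unfold pderiv
  rw [h2, h1.deriv]
  simp only [Complex.reCLM_apply, trig, AddCircle.coe_zero, fourier_eval_zero, mul_one]
  congr 1; ring

lemma pderiv_pderiv_trig (c : ℂ) (n : Fin d → ℤ) (i : Fin d) (x : Torus L d) :
    pderiv i (pderiv i (trig c n)) x = -(2 * Real.pi * n i / L) ^ 2 * trig c n x := by
  rw [pderiv_trig, pderiv_trig, trig, trig]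
  have : (2 * Real.pi * Complex.I * n i / L * (2 * Real.pi * Complex.I * n i / L * c) : ℂ) =
      ((-(2 * Real.pi * n i / L) ^ 2 : ℝ) : ℂ) * c := by
    push_cast
    linear_combination (2 * Real.pi * n i / L : ℂ) ^ 2 * c * Complex.I_sq
  rw [this, mul_assoc, Complex.re_ofReal_mul]

/-- An `L²` function orthogonal to all trigonometric monomials vanishes. -/
lemma Lp_eq_zero_of_trig (f : Lp ℝ 2 (volume : Measure (Torus L d)))
    (h : ∀ (c : ℂ) (n : Fin d → ℤ), ∫ x, f x * trig c n x = 0) : f = 0 := by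
  have hf : Integrable f volume := (Lp.memLp f).integrable (by norm_num)
  have hprod (F : C(Torus L d, ℂ)) : Integrable (fun x => F x * (f x : ℂ)) volume := by
    obtain ⟨K, hK⟩ := isCompact_univ.exists_bound_of_continuousOn (f := F) F.continuous.continuousOn
    exact hf.ofReal.bdd_mul (c := K) F.continuous.aestronglyMeasurable
      (ae_of_all _ fun x => hK x trivial)
  -- The continuous functions annihilated by `f` form a closed subspace. It contains the characters,
  -- hence is everything by Stone–Weierstrass; density of continuous functions in `L²` then gives `f
  -- = 0`.
  let S : Submodule ℂ C(Torus L d, ℂ) :=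
    { carrier := {F | ∫ x, F x * (f x : ℂ) = 0}
      zero_mem' := by simp
      add_mem' := by
        intro F G hF hG
        simp only [Set.mem_ofPred_eq, ContinuousMap.add_apply, add_mul] at *
        rw [integral_add (hprod F) (hprod G), hF, hG, add_zero]
      smul_mem' := by
        intro c F hF
        simp only [Set.mem_ofPred_eq, ContinuousMap.smul_apply, smul_eq_mul, mul_assoc] at *
        rw [integral_const_mul, hF, mul_zero] }
  have hSc : IsClosed (S : Set C(Torus L d, ℂ)) := by
    have hcont : Continuous fun F : C(Torus L d, ℂ) => ∫ x, F x * (f x : ℂ) := by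
      refine continuous_iff_continuousAt.2 fun F => ?_
      refine continuousAt_of_dominated (bound := fun x => (‖F‖ + 1) * ‖(f x : ℂ)‖)
        (Filter.Eventually.of_forall fun G => (hprod G).aestronglyMeasurable) ?_
        (hf.ofReal.norm.const_mul _) ?_
      · filter_upwards [Metric.ball_mem_nhds F one_pos] with G hG
        refine ae_of_all _ fun x => ?_
        rw [norm_mul]
        refine mul_le_mul_of_nonneg_right ((G.norm_coe_le_norm x).trans ?_) (norm_nonneg _)
        rw [Metric.mem_ball, dist_eq_norm] at hG
        have := norm_sub_norm_le G F
        linarith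
      · refine ae_of_all _ fun x => ?_
        exact ((ContinuousEvalConst.continuous_eval_const x).mul continuous_const).continuousAt
    exact isClosed_singleton.preimage hcont
  have hS : S = ⊤ := by
    rw [eq_top_iff, ← span_torusChar_closure_eq_top (L := L) (d := d)]
    refine Submodule.topologicalClosure_minimal _ (Submodule.span_le.2 ?_) hSc
    rintro _ ⟨n, rfl⟩
    change ∫ x, torusChar n x * (f x : ℂ) = 0
    -- The coefficients `1` and `-I` extract the real and the imaginary part of the character.
    have h1 := h 1 n
    have h2 := h (-Complex.I) n
    have e1 : ∫ x, (torusChar n x * (f x : ℂ)).re = 0 := by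
      rw [← h1]; congr 1; ext x; simp [trig, mul_comm]
    have e2 : ∫ x, (torusChar n x * (f x : ℂ)).im = 0 := by
      rw [← h2]; congr 1; ext x; simp [trig, mul_comm]
    have r1 := integral_re (𝕜 := ℂ) (hprod (torusChar n))
    have r2 := integral_im (𝕜 := ℂ) (hprod (torusChar n))
    simp only [RCLike.re_eq_complex_re, RCLike.im_eq_complex_im] at r1 r2
    apply Complex.ext
    · rw [← r1, e1]; rfl
    · rw [← r2, e2]; rfl
  have hdense := ContinuousMap.toLp_denseRange (E := ℝ) (p := 2)
    (μ := (volume : Measure (Torus L d))) (𝕜 := ℝ) (by norm_num)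
  have hinner (F : C(Torus L d, ℝ)) : inner ℝ (ContinuousMap.toLp 2 volume ℝ F) f = 0 := by
    have hF : (⟨fun x => (F x : ℂ), by fun_prop⟩ : C(Torus L d, ℂ)) ∈ S := by rw [hS]; trivial
    change ∫ x, (F x : ℂ) * (f x : ℂ) = 0 at hF
    simp_rw [← Complex.ofReal_mul] at hF
    rw [integral_complex_ofReal] at hF
    rw [L2.inner_def, ← Complex.ofReal_eq_zero.1 hF]
    refine integral_congr_ae ?_
    filter_upwards [ContinuousMap.coeFn_toLp (p := 2) (𝕜 := ℝ) volume F] with x hx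
    rw [hx]; simp [mul_comm]
  exact hdense.eq_zero_of_inner_right (𝕜 := ℝ) hinner

end GrandCanonical

/-- Dominated convergence applied to the squares of the differences; used whenever gradients are
multiplied by bounded factors that converge almost everywhere. -/
lemma MeasureTheory.tendsto_eLpNorm_two_of_dominated {α : Type*} [MeasurableSpace α]
    {μ : Measure α} {F : ℕ → α → ℝ} {f g : α → ℝ} (hF : ∀ n, AEStronglyMeasurable (F n) μ)
    (hf : AEStronglyMeasurable f μ) (hg : MemLp g 2 μ) (hb : ∀ n, ∀ᵐ x ∂μ, |F n x - f x| ≤ g x)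
    (hlim : ∀ᵐ x ∂μ, Tendsto (fun n => F n x) atTop (𝓝 (f x))) :
    Tendsto (fun n => eLpNorm (F n - f) 2 μ) atTop (𝓝 0) := by
  have key : Tendsto (fun n => ∫⁻ x, ‖(F n - f) x‖ₑ ^ (2 : ℝ) ∂μ) atTop
      (𝓝 (∫⁻ _, 0 ∂μ)) := by
    refine tendsto_lintegral_of_dominated_convergence' (fun x => ‖g x‖ₑ ^ (2 : ℝ))
      (fun n => ((hF n).sub hf).enorm.pow_const _) ?_ ?_ ?_
    · intro n
      filter_upwards [hb n] with x hx
      refine ENNReal.rpow_le_rpow ?_ (by norm_num)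
      exact enorm_le_iff_norm_le.2 (by simpa using hx.trans (le_abs_self _))
    · have := lintegral_rpow_enorm_lt_top_of_eLpNorm_lt_top (by norm_num) (by norm_num) hg.2
      simpa using this.ne
    · filter_upwards [hlim] with x hx
      have h1 : Tendsto (fun n => (F n - f) x) atTop (𝓝 0) := by
        simpa using hx.sub_const (f x)
      have h2 := (ENNReal.continuous_rpow_const (y := (2 : ℝ))).continuousAt.tendsto.comp h1.enorm
      simpa [Function.comp_def] using h2
  simp only [lintegral_zero] at key
  have h2 := (ENNReal.continuous_rpow_const (y := (1 / 2 : ℝ))).continuousAt.tendsto.comp key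
  have h3 : ((0 : ENNReal) ^ (1 / 2 : ℝ)) = 0 := by simp
  rw [h3] at h2
  refine h2.congr fun n => ?_
  simp [eLpNorm_eq_lintegral_rpow_enorm_toReal (p := 2) (by norm_num) (by norm_num)]

/-! ### Jets, `H^1` as a closed subspace, and density of test functions. -/

namespace GrandCanonical

variable {L : ℝ} [Fact (0 < L)] {d : ℕ}

variable (L d) in
/-- The Hilbert space of `1 + d` square-integrable functions: a value and `d` derivatives. -/
abbrev Jets : Type := PiLp 2 fun _ : Option (Fin d) => Lp ℝ 2 (volume : Measure (Torus L d))

open Classical in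
/-- The element of `Jets` given by square-integrable components. -/
def toJet (F : Option (Fin d) → Torus L d → ℝ) : Jets L d :=
  WithLp.toLp 2 fun o => if h : MemLp (F o) 2 volume then h.toLp (F o) else 0

lemma toJet_apply {F : Option (Fin d) → Torus L d → ℝ} (hF : ∀ o, MemLp (F o) 2 volume)
    (o : Option (Fin d)) : toJet F o = (hF o).toLp (F o) := by
  simp [toJet, hF o]

lemma coeFn_toJet {F : Option (Fin d) → Torus L d → ℝ} (hF : ∀ o, MemLp (F o) 2 volume)
    (o : Option (Fin d)) : toJet F o =ᵐ[volume] F o := by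
  rw [toJet_apply hF]
  exact MemLp.coeFn_toLp _

lemma memLp_jet (X : Jets L d) (o : Option (Fin d)) : MemLp (X o) 2 volume := Lp.memLp _

lemma inner_jets (X Y : Jets L d) : ⟪X, Y⟫ = ∑ o, ∫ x, X o x * Y o x := by
  rw [PiLp.inner_apply]
  refine Finset.sum_congr rfl fun o _ => ?_
  rw [L2.inner_def]
  congr 1; ext x
  simp [mul_comm]

lemma inner_toJet (X : Jets L d) {F : Option (Fin d) → Torus L d → ℝ}
    (hF : ∀ o, MemLp (F o) 2 volume) : ⟪X, toJet F⟫ = ∑ o, ∫ x, X o x * F o x := by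
  rw [inner_jets]
  refine Finset.sum_congr rfl fun o _ => integral_congr_ae ?_
  filter_upwards [coeFn_toJet hF o] with x hx
  rw [hx]

lemma inner_toJet_toJet {E F : Option (Fin d) → Torus L d → ℝ}
    (hE : ∀ o, MemLp (E o) 2 volume) (hF : ∀ o, MemLp (F o) 2 volume) :
    ⟪toJet E, toJet F⟫ = ∑ o, ∫ x, E o x * F o x := by
  rw [inner_toJet _ hF]
  refine Finset.sum_congr rfl fun o _ => integral_congr_ae ?_
  filter_upwards [coeFn_toJet hE o] with x hx
  rw [hx]

lemma jet_ext {X Y : Jets L d} (h : ∀ o, X o =ᵐ[volume] Y o) : X = Y := by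
  ext1 o
  exact Lp.ext (h o)

lemma toJet_coe (X : Jets L d) : toJet (fun o => X o) = X :=
  jet_ext fun o => coeFn_toJet (fun o => memLp_jet X o) o

lemma jet_add_apply (X Y : Jets L d) (o : Option (Fin d)) :
    (X + Y) o =ᵐ[volume] fun x => X o x + Y o x := by
  rw [PiLp.add_apply]; exact Lp.coeFn_add _ _

lemma jet_sub_apply (X Y : Jets L d) (o : Option (Fin d)) :
    (X - Y) o =ᵐ[volume] fun x => X o x - Y o x := by
  rw [PiLp.sub_apply]; exact Lp.coeFn_sub _ _

lemma jet_smul_apply (c : ℝ) (X : Jets L d) (o : Option (Fin d)) :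
    (c • X) o =ᵐ[volume] fun x => c * X o x := by
  rw [PiLp.smul_apply]; exact Lp.coeFn_smul _ _

lemma toJet_add {E F : Option (Fin d) → Torus L d → ℝ}
    (hE : ∀ o, MemLp (E o) 2 volume) (hF : ∀ o, MemLp (F o) 2 volume) :
    toJet (fun o x => E o x + F o x) = toJet E + toJet F := by
  refine jet_ext fun o => ?_
  filter_upwards [coeFn_toJet hE o, coeFn_toJet hF o, jet_add_apply (toJet E) (toJet F) o,
    coeFn_toJet (F := fun o x => E o x + F o x) (fun o => (hE o).add (hF o)) o] with x h1 h2 h3 h4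
  rw [h4, h3, h1, h2]

lemma toJet_smul {E : Option (Fin d) → Torus L d → ℝ} (c : ℝ)
    (hE : ∀ o, MemLp (E o) 2 volume) :
    toJet (fun o x => c * E o x) = c • toJet E := by
  refine jet_ext fun o => ?_
  filter_upwards [coeFn_toJet hE o, jet_smul_apply c (toJet E) o,
    coeFn_toJet (F := fun o x => c * E o x) (fun o => (hE o).const_mul c) o] with x h1 h3 h4
  rw [h4, h3, h1]

lemma toJet_sub {E F : Option (Fin d) → Torus L d → ℝ}
    (hE : ∀ o, MemLp (E o) 2 volume) (hF : ∀ o, MemLp (F o) 2 volume) :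
    toJet (fun o x => E o x - F o x) = toJet E - toJet F := by
  refine jet_ext fun o => ?_
  filter_upwards [coeFn_toJet hE o, coeFn_toJet hF o, jet_sub_apply (toJet E) (toJet F) o,
    coeFn_toJet (F := fun o x => E o x - F o x) (fun o => (hE o).sub (hF o)) o] with x h1 h2 h3 h4
  rw [h4, h3, h1, h2]

lemma tendsto_jets_iff {X : ℕ → Jets L d} {Y : Jets L d} :
    Tendsto X atTop (𝓝 Y) ↔
      ∀ o, Tendsto (fun n => eLpNorm (⇑(X n o) - ⇑(Y o)) 2 volume) atTop (𝓝 0) := by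
  have h1 : Tendsto X atTop (𝓝 Y) ↔ Tendsto (fun n => WithLp.ofLp (X n)) atTop (𝓝 (WithLp.ofLp Y)) :=
    ((PiLp.homeomorph 2 fun _ : Option (Fin d) =>
      Lp ℝ 2 (volume : Measure (Torus L d))).isInducing.tendsto_nhds_iff)
  rw [h1, tendsto_pi_nhds]
  exact forall_congr' fun o => Lp.tendsto_Lp_iff_tendsto_eLpNorm' _ _

lemma tendsto_toJet {F : ℕ → Option (Fin d) → Torus L d → ℝ} {f : Option (Fin d) → Torus L d → ℝ}
    (hF : ∀ n o, MemLp (F n o) 2 volume) (hf : ∀ o, MemLp (f o) 2 volume)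
    (h : ∀ o, Tendsto (fun n => eLpNorm (F n o - f o) 2 volume) atTop (𝓝 0)) :
    Tendsto (fun n => toJet (F n)) atTop (𝓝 (toJet f)) := by
  refine tendsto_jets_iff.2 fun o => (h o).congr fun n => eLpNorm_congr_ae ?_
  exact ((coeFn_toJet (hF n) o).sub (coeFn_toJet hf o)).symm

/-- The value `f` together with the derivatives `g`. -/
def pair (f : Torus L d → ℝ) (g : Fin d → Torus L d → ℝ) : Option (Fin d) → Torus L d → ℝ
  | none => f
  | some i => g i

lemma HasH1Grad.memLp_pair {f : Torus L d → ℝ} {g : Fin d → Torus L d → ℝ} (h : HasH1Grad f g)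
    (o : Option (Fin d)) : MemLp (pair f g o) 2 volume := by
  cases o with
  | none => exact h.memLp
  | some i => exact h.memLp_grad i

lemma memLp_pair_test {ψ : Torus L d → ℝ} (h : IsTest ψ) (o : Option (Fin d)) :
    MemLp (pair ψ (fun i => pderiv i ψ) o) 2 volume := h.isCk.hasH1Grad.memLp_pair o

variable (L d) in
/-- The subspace of the jets of test functions. -/
def testJets : Submodule ℝ (Jets L d) where
  carrier := {X | ∃ ψ, IsTest ψ ∧ X = toJet (pair ψ fun i => pderiv i ψ)}
  zero_mem' := by
    refine ⟨fun _ => 0, isCk_const 0, jet_ext fun o => ?_⟩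
    refine EventuallyEq.trans ?_ (coeFn_toJet (memLp_pair_test (isCk_const 0)) o).symm
    rw [PiLp.zero_apply]
    filter_upwards [Lp.coeFn_zero ℝ 2 (volume : Measure (Torus L d))] with x hx
    rw [hx]
    cases o <;> simp [pair, pderiv_const]
  add_mem' := by
    rintro _ _ ⟨ψ, hψ, rfl⟩ ⟨χ, hχ, rfl⟩
    refine ⟨fun x => ψ x + χ x, IsCk.add hψ hχ, ?_⟩
    rw [← toJet_add (memLp_pair_test hψ) (memLp_pair_test hχ)]
    congr 1; funext o x
    cases o <;> simp [pair, pderiv_add hψ.isCk hχ.isCk]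
  smul_mem' := by
    rintro c _ ⟨ψ, hψ, rfl⟩
    refine ⟨fun x => c * ψ x, IsCk.const_mul c hψ, ?_⟩
    rw [← toJet_smul c (memLp_pair_test hψ)]
    congr 1; funext o x
    cases o <;> simp [pair, pderiv_const_mul c hψ.isCk]

/-- The jet whose orthogonality expresses the weak derivative in direction `i` tested with `ψ`. -/
def weakJet (i : Fin d) (ψ : Torus L d → ℝ) : Option (Fin d) → Torus L d → ℝ :=
  pair (pderiv i ψ) fun j x => if j = i then ψ x else 0

lemma memLp_weakJet {ψ : Torus L d → ℝ} (h : IsTest ψ) (i : Fin d) (o : Option (Fin d)) :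
    MemLp (weakJet i ψ o) 2 volume := by
  cases o with
  | none => exact memLp_of_continuous (h.isCk.continuous_pderiv i) 2
  | some j =>
    by_cases hj : j = i
    · simpa [weakJet, pair, hj] using memLp_of_continuous h.continuous 2
    · simp [weakJet, pair, hj]

lemma inner_weakJet (X : Jets L d) {ψ : Torus L d → ℝ} (h : IsTest ψ) (i : Fin d) :
    ⟪X, toJet (weakJet i ψ)⟫ = (∫ x, X none x * pderiv i ψ x) + ∫ x, X (some i) x * ψ x := by
  rw [inner_toJet X (memLp_weakJet h i), Fintype.sum_option, Finset.sum_eq_single i]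
  · simp [weakJet, pair]
  · intro j _ hj
    simp [weakJet, pair, hj]
  · simp

variable (L d) in
/-- The closed subspace of the jets of `H^1` functions. -/
def weakJets : Submodule ℝ (Jets L d) :=
  (Submodule.span ℝ {Y | ∃ i ψ, IsTest ψ ∧ Y = toJet (weakJet i ψ)})ᗮ

lemma mem_weakJets {X : Jets L d} : X ∈ weakJets L d ↔ ∀ (i : Fin d) (ψ : Torus L d → ℝ), IsTest ψ →
    ∫ x, X none x * pderiv i ψ x = - ∫ x, X (some i) x * ψ x := by
  rw [weakJets, Submodule.mem_orthogonal']
  constructor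
  · intro h i ψ hψ
    have := h _ (Submodule.subset_span ⟨i, ψ, hψ, rfl⟩)
    rw [inner_weakJet X hψ] at this
    linarith
  · intro h Y hY
    induction hY using Submodule.span_induction with
    | mem Y hY =>
      obtain ⟨i, ψ, hψ, rfl⟩ := hY
      rw [inner_weakJet X hψ, h i ψ hψ]; ring
    | zero => simp
    | add Y Z _ _ hY hZ => rw [inner_add_right, hY, hZ, add_zero]
    | smul c Y _ hY => rw [inner_smul_right, hY, mul_zero]

lemma mem_weakJets_iff_hasH1Grad {X : Jets L d} :
    X ∈ weakJets L d ↔ HasH1Grad (X none) fun i => X (some i) := by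
  rw [mem_weakJets]
  exact ⟨fun h => ⟨memLp_jet X none, fun i => memLp_jet X (some i), h⟩, fun h => h.weak⟩

lemma HasH1Grad.congr {f f' : Torus L d → ℝ} {g g' : Fin d → Torus L d → ℝ} (h : HasH1Grad f g)
    (hf : f =ᵐ[volume] f') (hg : ∀ i, g i =ᵐ[volume] g' i) : HasH1Grad f' g' where
  memLp := h.memLp.ae_eq hf
  memLp_grad i := (h.memLp_grad i).ae_eq (hg i)
  weak i ψ hψ := by
    have e1 : ∫ x, f' x * pderiv i ψ x = ∫ x, f x * pderiv i ψ x := by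
      refine integral_congr_ae ?_
      filter_upwards [hf] with x hx; rw [hx]
    have e2 : ∫ x, g' i x * ψ x = ∫ x, g i x * ψ x := by
      refine integral_congr_ae ?_
      filter_upwards [hg i] with x hx; rw [hx]
    rw [e1, e2, h.weak i ψ hψ]

lemma HasH1Grad.toJet_mem {f : Torus L d → ℝ} {g : Fin d → Torus L d → ℝ} (h : HasH1Grad f g) :
    toJet (pair f g) ∈ weakJets L d :=
  mem_weakJets_iff_hasH1Grad.2 (h.congr (coeFn_toJet h.memLp_pair none).symm
    fun i => (coeFn_toJet h.memLp_pair (some i)).symm)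

/-- A trigonometric monomial `e` of frequency `k = 2πn/L` is an eigenfunction of every `∂ᵢ²`. For a
weak jet `X`, moving derivatives onto `∂ᵢ e` turns orthogonality to the jet of `e` into `(1 + |k|²)
∫ X₀ e = 0`. So the value component has no Fourier coefficients and vanishes, and then the weak
gradient vanishes with it. -/
lemma weakJets_inf_orthogonal : (testJets L d)ᗮ ⊓ weakJets L d = ⊥ := by
  rw [eq_bot_iff]
  rintro X ⟨hX1, hX2⟩
  rw [SetLike.mem_coe, Submodule.mem_orthogonal'] at hX1
  rw [SetLike.mem_coe, mem_weakJets] at hX2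
  have h0 : X none = 0 := by
    refine Lp_eq_zero_of_trig _ fun c n => ?_
    have hT := isTest_trig (L := L) c n
    have h1 := hX1 _ ⟨_, hT, rfl⟩
    rw [inner_toJet X (memLp_pair_test hT), Fintype.sum_option] at h1
    have h2 (i : Fin d) : ∫ x, X (some i) x * pderiv i (trig c n) x =
        (2 * Real.pi * n i / L) ^ 2 * ∫ x, X none x * trig c n x := by
      have := hX2 i _ (hT.pderiv i)
      rw [← neg_eq_iff_eq_neg] at this
      rw [← this, ← integral_const_mul, ← integral_neg]
      congr 1; ext x
      rw [pderiv_pderiv_trig]; ring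
    simp only [pair, h2, ← Finset.sum_mul] at h1
    have h3 : (1 + ∑ i, (2 * Real.pi * n i / L) ^ 2) * ∫ x, X none x * trig c n x = 0 := by
      linarith
    have h4 : 0 ≤ ∑ i, (2 * Real.pi * n i / L) ^ 2 := Finset.sum_nonneg fun i _ => sq_nonneg _
    exact (mul_eq_zero.1 h3).resolve_left (by positivity)
  have h5 (i : Fin d) : X (some i) = 0 := by
    refine Lp_eq_zero_of_trig _ fun c n => ?_
    have hT := isTest_trig (L := L) c n
    have := hX2 i _ hT
    rw [h0] at this
    have h6 : ∫ x, (0 : Lp ℝ 2 (volume : Measure (Torus L d))) x * pderiv i (trig c n) x = 0 := by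
      rw [← integral_zero (Torus L d) ℝ]
      refine integral_congr_ae ?_
      filter_upwards [Lp.coeFn_zero ℝ 2 (volume : Measure (Torus L d))] with x hx
      rw [hx]; simp
    linarith
  rw [Submodule.mem_bot]
  ext1 o
  cases o with
  | none => exact h0
  | some i => exact h5 i

/-- A closed subspace of a Hilbert space contained in another, with trivial orthogonal complement
inside it, is all of it. -/
lemma testJets_topologicalClosure : (testJets L d).topologicalClosure = weakJets L d := by
  have hle : (testJets L d).topologicalClosure ≤ weakJets L d := by
    refine Submodule.topologicalClosure_minimal _ ?_ (Submodule.isClosed_orthogonal _)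
    rintro _ ⟨ψ, hψ, rfl⟩
    exact hψ.isCk.hasH1Grad.toJet_mem
  have := Submodule.sup_orthogonal_inf_of_hasOrthogonalProjection hle
  rwa [Submodule.orthogonal_closure, weakJets_inf_orthogonal, sup_bot_eq] at this

/-- Test functions are dense in `H^1`. -/
lemma HasH1Grad.exists_seq {f : Torus L d → ℝ} {g : Fin d → Torus L d → ℝ} (h : HasH1Grad f g) :
    ∃ ψ : ℕ → Torus L d → ℝ, (∀ n, IsTest (ψ n)) ∧
      Tendsto (fun n => eLpNorm (ψ n - f) 2 volume) atTop (𝓝 0) ∧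
      ∀ i, Tendsto (fun n => eLpNorm (pderiv i (ψ n) - g i) 2 volume) atTop (𝓝 0) := by
  have hm : toJet (pair f g) ∈ closure (testJets L d : Set (Jets L d)) := by
    rw [← Submodule.topologicalClosure_coe, testJets_topologicalClosure]
    exact h.toJet_mem
  obtain ⟨X, hX, hlim⟩ := mem_closure_iff_seq_limit.1 hm
  choose ψ hψ hXψ using hX
  rw [tendsto_jets_iff] at hlim
  have key (o : Option (Fin d)) : Tendsto (fun n =>
      eLpNorm (pair (ψ n) (fun i => pderiv i (ψ n)) o - pair f g o) 2 volume) atTop (𝓝 0) := by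
    refine (hlim o).congr fun n => eLpNorm_congr_ae ?_
    rw [hXψ n]
    exact (coeFn_toJet (memLp_pair_test (hψ n)) o).sub (coeFn_toJet h.memLp_pair o)
  exact ⟨ψ, hψ, key none, fun i => key (some i)⟩

/-! ### Weighted jets and the pairing of `L¹` functions with `H^1` functions. -/

/-- Weights on jets which are measurable and bounded between `c > 0` and `C`. -/
structure IsWeight (s : Option (Fin d) → Torus L d → ℝ) (c C : ℝ) : Prop where
  measurable : ∀ o, Measurable (s o)
  pos : 0 < c
  lower : ∀ o x, c ≤ s o x
  upper : ∀ o x, s o x ≤ C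

/-- The weighted jet of a function `f` with gradient `g`. -/
def wjet (s : Option (Fin d) → Torus L d → ℝ) (f : Torus L d → ℝ)
    (g : Fin d → Torus L d → ℝ) : Jets L d :=
  toJet fun o x => s o x * pair f g o x

section Weight

variable {s : Option (Fin d) → Torus L d → ℝ} {c C : ℝ}

lemma IsWeight.pos_apply (hs : IsWeight s c C) (o : Option (Fin d)) (x : Torus L d) :
    0 < s o x := hs.pos.trans_le (hs.lower o x)

lemma IsWeight.abs_le (hs : IsWeight s c C) (o : Option (Fin d)) (x : Torus L d) :
    |s o x| ≤ C := by
  rw [abs_of_pos (hs.pos_apply o x)]; exact hs.upper o x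

lemma IsWeight.upper_pos (hs : IsWeight s c C) : 0 < C :=
  (hs.pos_apply none 0).trans_le (hs.upper none 0)

lemma IsWeight.memLp_mul (hs : IsWeight s c C) {f : Torus L d → ℝ} (hf : MemLp f 2 volume)
    (o : Option (Fin d)) : MemLp (fun x => s o x * f x) 2 volume :=
  (hf.const_mul C).mono ((hs.measurable o).aestronglyMeasurable.mul hf.1)
    (ae_of_all _ fun x => by
      rw [norm_mul, norm_mul]
      exact mul_le_mul_of_nonneg_right ((hs.abs_le o x).trans (le_abs_self C)) (norm_nonneg _))

lemma IsWeight.memLp_div (hs : IsWeight s c C) {f : Torus L d → ℝ} (hf : MemLp f 2 volume)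
    (o : Option (Fin d)) : MemLp (fun x => f x / s o x) 2 volume :=
  (hf.const_mul c⁻¹).mono (hf.1.aemeasurable.div (hs.measurable o).aemeasurable).aestronglyMeasurable
    (ae_of_all _ fun x => by
      have := hs.pos
      have h2 := hs.pos_apply o x
      rw [norm_mul, norm_div, div_eq_inv_mul]
      refine mul_le_mul_of_nonneg_right ?_ (norm_nonneg _)
      rw [Real.norm_of_nonneg h2.le, Real.norm_of_nonneg (by positivity)]
      exact inv_anti₀ this (hs.lower o x))

lemma IsWeight.tendsto_toJet (hs : IsWeight s c C) {F : ℕ → Option (Fin d) → Torus L d → ℝ}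
    {f : Option (Fin d) → Torus L d → ℝ}
    (hF : ∀ n o, MemLp (F n o) 2 volume) (hf : ∀ o, MemLp (f o) 2 volume)
    (h : ∀ o, Tendsto (fun n => eLpNorm (F n o - f o) 2 volume) atTop (𝓝 0)) :
    Tendsto (fun n => toJet fun o x => s o x * F n o x) atTop
      (𝓝 (toJet fun o x => s o x * f o x)) := by
  refine GrandCanonical.tendsto_toJet (fun n o => hs.memLp_mul (hF n o) o)
    (fun o => hs.memLp_mul (hf o) o) fun o => ?_
  have h1 := ENNReal.Tendsto.const_mul (a := ENNReal.ofReal C) (h o) (Or.inr ENNReal.ofReal_ne_top)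
  rw [mul_zero] at h1
  refine tendsto_of_tendsto_of_tendsto_of_le_of_le tendsto_const_nhds h1 (fun n => zero_le) ?_
  intro n
  refine eLpNorm_le_mul_eLpNorm_of_ae_le_mul (ae_of_all _ fun x => ?_) 2
  simp only [Pi.sub_apply, ← mul_sub, norm_mul]
  exact mul_le_mul_of_nonneg_right (hs.abs_le o x) (norm_nonneg _)

lemma HasH1Grad.memLp_wpair (hs : IsWeight s c C) {f : Torus L d → ℝ}
    {g : Fin d → Torus L d → ℝ} (h : HasH1Grad f g) (o : Option (Fin d)) :
    MemLp (fun x => s o x * pair f g o x) 2 volume := hs.memLp_mul (h.memLp_pair o) o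

/-- `u` acts on test functions as the functional `⟪ζ, ·⟫`. -/
def Represents (s : Option (Fin d) → Torus L d → ℝ) (ζ : Jets L d) (u : Torus L d → ℝ) : Prop :=
  ∀ ψ : Torus L d → ℝ, IsTest ψ → ∫ x, u x * ψ x = ⟪ζ, wjet s ψ fun i => pderiv i ψ⟫

lemma Represents.sub {ζ ξ : Jets L d} {u v : Torus L d → ℝ} (hu : Integrable u)
    (hv : Integrable v) (h : Represents s ζ u) (h' : Represents s ξ v) :
    Represents s (ζ - ξ) fun x => u x - v x := by
  intro ψ hψ
  obtain ⟨K, -, hK⟩ := exists_bound hψ.continuous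
  rw [inner_sub_left, ← h ψ hψ, ← h' ψ hψ, ← integral_sub]
  · congr 1; ext x; ring
  · exact hu.mul_bdd hψ.continuous.aestronglyMeasurable (ae_of_all _ hK)
  · exact hv.mul_bdd hψ.continuous.aestronglyMeasurable (ae_of_all _ hK)

/-- Bounded smooth functions of `H^1` functions are admissible in the pairing. -/
lemma Represents.integral_comp (hs : IsWeight s c C) {ζ : Jets L d} {u : Torus L d → ℝ}
    (hu : Integrable u) (hζ : Represents s ζ u) {v : Torus L d → ℝ} {k : Fin d → Torus L d → ℝ}
    (hv : HasH1Grad v k) {T T' : ℝ → ℝ} (hT : ContDiff ℝ ((⊤ : ℕ∞) : WithTop ℕ∞) T)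
    (hT' : ∀ t, HasDerivAt T (T' t) t) (hT'c : Continuous T') (hT'b : ∀ t, |T' t| ≤ 1) {K : ℝ}
    (hTb : ∀ t, |T t| ≤ K) :
    ∫ x, u x * T (v x) = ⟪ζ, wjet s (fun x => T (v x)) fun i x => T' (v x) * k i x⟫ := by
  obtain ⟨ψ₀, hψ₀, hlim₀, hlimg₀⟩ := hv.exists_seq
  have hmeas : TendstoInMeasure volume ψ₀ atTop v :=
    tendstoInMeasure_of_tendsto_eLpNorm (by norm_num)
      (fun n => (hψ₀ n).continuous.aestronglyMeasurable) hv.memLp.1 hlim₀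
  -- Convergence almost everywhere along a subsequence is needed for dominated convergence on both
  -- sides: `u` is only integrable, and `T' (ψ n)` multiplies the fixed gradient `k`.
  obtain ⟨ns, hns, hae⟩ := hmeas.exists_seq_tendsto_ae
  set ψ : ℕ → Torus L d → ℝ := fun n => ψ₀ (ns n) with hψdef
  have hψ (n) : IsTest (ψ n) := hψ₀ (ns n)
  have hlim : Tendsto (fun n => eLpNorm (ψ n - v) 2 volume) atTop (𝓝 0) :=
    hlim₀.comp hns.tendsto_atTop
  have hlimg (i) : Tendsto (fun n => eLpNorm (pderiv i (ψ n) - k i) 2 volume) atTop (𝓝 0) :=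
    (hlimg₀ i).comp hns.tendsto_atTop
  have hTd : Differentiable ℝ T := fun t => (hT' t).differentiableAt
  have hTψ (n) : IsTest fun x => T (ψ n x) := IsCk.comp hT (hψ n)
  have hpd (n) (i) (x) : pderiv i (fun x => T (ψ n x)) x = T' (ψ n x) * pderiv i (ψ n) x := by
    rw [pderiv_comp hTd (hψ n).isCk, (hT' _).deriv]
  have hlip (a b : ℝ) : |T a - T b| ≤ |a - b| := by
    have := Convex.norm_image_sub_le_of_norm_hasDerivWithin_le (f := T) (f' := T') (C := 1)
      (s := Set.univ) (x := b) (y := a) (fun t _ => (hT' t).hasDerivWithinAt)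
      (fun t _ => hT'b t) convex_univ trivial trivial
    simpa using this
  have hTv : AEStronglyMeasurable (fun x => T (v x)) volume :=
    hT.continuous.comp_aestronglyMeasurable hv.memLp.1
  have hT'v : AEStronglyMeasurable (fun x => T' (v x)) volume :=
    hT'c.comp_aestronglyMeasurable hv.memLp.1
  have hT'ψ (n) : Continuous (fun x => T' (ψ n x)) := hT'c.comp (hψ n).continuous
  have hleft : Tendsto (fun n => ∫ x, u x * T (ψ n x)) atTop (𝓝 (∫ x, u x * T (v x))) := by
    refine tendsto_integral_of_dominated_convergence (fun x => |u x| * K) (fun n =>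
      hu.1.mul (hTψ n).continuous.aestronglyMeasurable) (hu.abs.mul_const K) ?_ ?_
    · refine fun n => ae_of_all _ fun x => ?_
      rw [norm_mul]
      exact mul_le_mul_of_nonneg_left (hTb _) (norm_nonneg _)
    · filter_upwards [hae] with x hx
      exact ((hT.continuous.tendsto _).comp hx).const_mul _
  have hmem (o) : MemLp (pair (fun x => T (v x)) (fun i x => T' (v x) * k i x) o) 2 volume := by
    cases o with
    | none => exact MemLp.of_bound hTv K (ae_of_all _ fun x => hTb _)
    | some i =>
      refine (hv.memLp_grad i).mono (hT'v.mul (hv.memLp_grad i).1) (ae_of_all _ fun x => ?_)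
      simp only [pair, norm_mul]
      exact mul_le_of_le_one_left (norm_nonneg _) (hT'b _)
  have hright : Tendsto (fun n => wjet s (fun x => T (ψ n x))
      fun i => pderiv i fun x => T (ψ n x)) atTop
      (𝓝 (wjet s (fun x => T (v x)) fun i x => T' (v x) * k i x)) := by
    refine hs.tendsto_toJet (fun n o => memLp_pair_test (hTψ n) o) hmem fun o => ?_
    cases o with
    | none =>
      refine tendsto_of_tendsto_of_tendsto_of_le_of_le tendsto_const_nhds hlim
        (fun n => zero_le) fun n => eLpNorm_mono fun x => ?_
      exact hlip _ _
    | some i =>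
      have h2 : Tendsto (fun n => eLpNorm ((fun x => T' (ψ n x) * k i x) -
          fun x => T' (v x) * k i x) 2 volume) atTop (𝓝 0) := by
        refine tendsto_eLpNorm_two_of_dominated (g := fun x => 2 * |k i x|)
          (fun n => (hT'ψ n).aestronglyMeasurable.mul (hv.memLp_grad i).1)
          (hT'v.mul (hv.memLp_grad i).1) ((hv.memLp_grad i).abs.const_mul 2) ?_ ?_
        · refine fun n => ae_of_all _ fun x => ?_
          rw [← sub_mul, abs_mul]
          refine mul_le_mul_of_nonneg_right ?_ (abs_nonneg _)
          have := abs_sub (T' (ψ n x)) (T' (v x))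
          linarith [hT'b (ψ n x), hT'b (v x)]
        · filter_upwards [hae] with x hx
          exact ((hT'c.tendsto _).comp hx).mul_const _
      have h3 := (hlimg i).add h2
      rw [add_zero] at h3
      refine tendsto_of_tendsto_of_tendsto_of_le_of_le tendsto_const_nhds h3
        (fun n => zero_le) fun n => ?_
      -- The first summand is small because `|T'| ≤ 1` and the gradients converge in `L²`; the
      -- second by dominated convergence with majorant `2 |k i|`.
      have hdec : (pair (fun x => T (ψ n x)) (fun i => pderiv i fun x => T (ψ n x)) (some i) -
          pair (fun x => T (v x)) (fun i x => T' (v x) * k i x) (some i)) =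
          (fun x => T' (ψ n x) * (pderiv i (ψ n) - k i) x) +
          ((fun x => T' (ψ n x) * k i x) - fun x => T' (v x) * k i x) := by
        ext x
        simp only [pair, Pi.sub_apply, Pi.add_apply, hpd]
        ring
      have hmk : AEStronglyMeasurable (pderiv i (ψ n) - k i) volume :=
        ((hψ n).isCk.continuous_pderiv i).aestronglyMeasurable.sub (hv.memLp_grad i).1
      change eLpNorm (pair (fun x => T (ψ n x)) (fun i => pderiv i fun x => T (ψ n x)) (some i) -
          pair (fun x => T (v x)) (fun i x => T' (v x) * k i x) (some i)) 2 volume ≤ _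
      rw [hdec]
      refine (eLpNorm_add_le ((hT'ψ n).aestronglyMeasurable.mul hmk)
        (((hT'ψ n).aestronglyMeasurable.mul (hv.memLp_grad i).1).sub
          (hT'v.mul (hv.memLp_grad i).1)) (by norm_num)).trans ?_
      refine add_le_add (eLpNorm_mono fun x => ?_) le_rfl
      rw [Pi.mul_apply, norm_mul]
      exact mul_le_of_le_one_left (norm_nonneg _) (hT'b _)
  refine tendsto_nhds_unique hleft (((tendsto_const_nhds (x := ζ)).inner hright).congr fun n => ?_)
  exact (hζ _ (hTψ n)).symm

/-- The smooth truncation at height of order `n + 1`. -/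
def trunc (n : ℕ) (t : ℝ) : ℝ := (n + 1) * Real.arctan (t / (n + 1))

lemma hasDerivAt_trunc (n : ℕ) (t : ℝ) :
    HasDerivAt (trunc n) (1 / (1 + (t / (n + 1)) ^ 2)) t := by
  have h := (((hasDerivAt_id t).div_const ((n : ℝ) + 1)).arctan).const_mul ((n : ℝ) + 1)
  have h0 : (n : ℝ) + 1 ≠ 0 := by positivity
  refine h.congr_deriv ?_
  simp only [id]
  field_simp

lemma contDiff_trunc (n : ℕ) : ContDiff ℝ ((⊤ : ℕ∞) : WithTop ℕ∞) (trunc n) :=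
  contDiff_const.mul (Real.contDiff_arctan.comp (contDiff_id.div_const _))

lemma deriv_trunc_mem (n : ℕ) (t : ℝ) :
    0 ≤ 1 / (1 + (t / (n + 1)) ^ 2) ∧ 1 / (1 + (t / (n + 1)) ^ 2) ≤ 1 := by
  refine ⟨by positivity, ?_⟩
  rw [div_le_one (by positivity)]
  nlinarith [sq_nonneg (t / (n + 1))]

lemma abs_trunc_le (n : ℕ) (t : ℝ) : |trunc n t| ≤ (n + 1) * (Real.pi / 2) := by
  rw [trunc, abs_mul, abs_of_pos (by positivity : (0 : ℝ) < n + 1)]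
  refine mul_le_mul_of_nonneg_left ?_ (by positivity)
  exact (abs_lt.2 ⟨Real.neg_pi_div_two_lt_arctan _, Real.arctan_lt_pi_div_two _⟩).le

/-- Both `trunc n` and `t - trunc n t` are monotone and vanish at `0`, the derivative of `trunc n`
lying in `[0, 1]`. In this form truncating `v` only shrinks the product `u v` and keeps its sign, so
a one-sided bound on `u v` survives. -/
lemma exists_trunc_eq (n : ℕ) (t : ℝ) : ∃ θ : ℝ, 0 ≤ θ ∧ θ ≤ 1 ∧ trunc n t = θ * t := by
  have h0 : (0 : ℝ) < n + 1 := by positivity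
  by_cases ht : t = 0
  · exact ⟨0, le_rfl, zero_le_one, by simp [ht, trunc]⟩
  have hmono : Monotone (trunc n) := monotone_of_hasDerivAt_nonneg (hasDerivAt_trunc n)
    fun t => (deriv_trunc_mem n t).1
  have hmono' : Monotone fun t => t - trunc n t :=
    monotone_of_hasDerivAt_nonneg (fun t => (hasDerivAt_id t).sub (hasDerivAt_trunc n t))
      fun t => by simpa using (deriv_trunc_mem n t).2
  have hz : trunc n 0 = 0 := by simp [trunc]
  refine ⟨trunc n t / t, ?_, ?_, by field_simp⟩
  · rcases lt_or_gt_of_ne ht with h | h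
    · exact div_nonneg_of_nonpos (hz ▸ hmono h.le) h.le
    · exact div_nonneg (hz ▸ hmono h.le) h.le
  · rcases lt_or_gt_of_ne ht with h | h
    · rw [div_le_one_of_neg h]
      have := hmono' h.le
      simp only [hz] at this; linarith
    · rw [div_le_one h]
      have := hmono' h.le
      simp only [hz] at this; linarith

lemma tendsto_natCast_succ : Tendsto (fun n : ℕ => ((n : ℝ) + 1)) atTop atTop :=
  tendsto_atTop_add_const_right _ _ tendsto_natCast_atTop_atTop

lemma tendsto_deriv_trunc (t : ℝ) :
    Tendsto (fun n : ℕ => 1 / (1 + (t / ((n : ℝ) + 1)) ^ 2)) atTop (𝓝 1) := by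
  have h1 : Tendsto (fun n : ℕ => t / ((n : ℝ) + 1)) atTop (𝓝 0) :=
    tendsto_natCast_succ.const_div_atTop t
  have h2 := ((h1.pow 2).const_add 1).inv₀ (by norm_num)
  simpa using h2

lemma tendsto_trunc (t : ℝ) : Tendsto (fun n => trunc n t) atTop (𝓝 t) := by
  -- With `a = 1 / (n + 1)`, the truncation is the difference quotient of `a ↦ arctan (a t)` at `0`.
  have h1 : HasDerivAt (fun a => Real.arctan (a * t)) t 0 := by
    have := ((hasDerivAt_id (0 : ℝ)).mul_const t).arctan
    simpa using this
  have h2 : Tendsto (fun n : ℕ => ((n : ℝ) + 1)⁻¹) atTop (𝓝[≠] 0) := by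
    refine tendsto_nhdsWithin_iff.2 ⟨tendsto_inv_atTop_zero.comp tendsto_natCast_succ, ?_⟩
    refine Eventually.of_forall fun n => ?_
    have : (n : ℝ) + 1 ≠ 0 := by positivity
    simpa using this
  refine ((hasDerivAt_iff_tendsto_slope.1 h1).comp h2).congr fun n => ?_
  simp [slope_def_field, trunc, div_eq_inv_mul, Function.comp]

/-- If an integrable `u` represents a functional on `H^1` and `v ∈ H^1` is such that `u v` is
bounded above by an integrable function, then `u v` is integrable and its integral is the value of
the functional. -/
lemma Represents.integral_mul (hs : IsWeight s c C) {ζ : Jets L d} {u : Torus L d → ℝ}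
    (hu : Integrable u) (hζ : Represents s ζ u) {v : Torus L d → ℝ} {k : Fin d → Torus L d → ℝ}
    (hv : HasH1Grad v k) {R : Torus L d → ℝ} (hR : Integrable R)
    (hle : ∀ᵐ x, u x * v x ≤ R x) :
    Integrable (fun x => u x * v x) ∧ ∫ x, u x * v x = ⟪ζ, wjet s v k⟫ := by
  have hstep (n : ℕ) := hζ.integral_comp hs hu hv (contDiff_trunc n) (hasDerivAt_trunc n)
    (by
      refine continuous_const.div (by fun_prop) fun t => ?_
      positivity)
    (fun t => by rw [abs_of_nonneg (deriv_trunc_mem n t).1]; exact (deriv_trunc_mem n t).2)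
    (abs_trunc_le n)
  have htm (n : ℕ) : AEStronglyMeasurable (fun x => trunc n (v x)) volume :=
    (contDiff_trunc n).continuous.comp_aestronglyMeasurable hv.memLp.1
  have hdm (n : ℕ) : AEStronglyMeasurable (fun x => 1 / (1 + (v x / ((n : ℝ) + 1)) ^ 2)) volume := by
    have : Continuous fun t : ℝ => 1 / (1 + (t / ((n : ℝ) + 1)) ^ 2) := by
      refine continuous_const.div (by fun_prop) fun t => ?_
      positivity
    exact this.comp_aestronglyMeasurable hv.memLp.1
  have habs (n : ℕ) (t : ℝ) : |trunc n t| ≤ |t| := by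
    obtain ⟨θ, h0, h1, h2⟩ := exists_trunc_eq n t
    rw [h2, abs_mul, abs_of_nonneg h0]
    exact mul_le_of_le_one_left (abs_nonneg _) h1
  have hmem (n : ℕ) (o) : MemLp (pair (fun x => trunc n (v x))
      (fun i x => 1 / (1 + (v x / ((n : ℝ) + 1)) ^ 2) * k i x) o) 2 volume := by
    cases o with
    | none => exact hv.memLp.mono (htm n) (ae_of_all _ fun x => habs n _)
    | some i =>
      refine (hv.memLp_grad i).mono ((hdm n).mul (hv.memLp_grad i).1) (ae_of_all _ fun x => ?_)
      simp only [pair]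
      rw [norm_mul, Real.norm_of_nonneg (deriv_trunc_mem n (v x)).1]
      exact mul_le_of_le_one_left (norm_nonneg _) (deriv_trunc_mem n (v x)).2
  have hjet : Tendsto (fun n => wjet s (fun x => trunc n (v x))
      fun i x => 1 / (1 + (v x / ((n : ℝ) + 1)) ^ 2) * k i x) atTop (𝓝 (wjet s v k)) := by
    refine hs.tendsto_toJet hmem hv.memLp_pair fun o => ?_
    cases o with
    | none =>
      refine tendsto_eLpNorm_two_of_dominated (g := fun x => 2 * |v x|) (fun n => (hmem n none).1)
        hv.memLp.1 (hv.memLp.abs.const_mul 2) ?_ ?_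
      · refine fun n => ae_of_all _ fun x => ?_
        have := abs_sub (trunc n (v x)) (v x)
        simp only [pair]
        linarith [habs n (v x)]
      · exact ae_of_all _ fun x => tendsto_trunc (v x)
    | some i =>
      refine tendsto_eLpNorm_two_of_dominated (g := fun x => |k i x|)
        (fun n => (hmem n (some i)).1) (hv.memLp_grad i).1 (hv.memLp_grad i).abs ?_ ?_
      · refine fun n => ae_of_all _ fun x => ?_
        have h := deriv_trunc_mem n (v x)
        simp only [pair]
        rw [← sub_one_mul, abs_mul]
        refine mul_le_of_le_one_left (abs_nonneg _) ?_
        rw [abs_le]; constructor <;> linarith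
      · refine ae_of_all _ fun x => ?_
        simpa [pair] using (tendsto_deriv_trunc (v x)).mul_const (k i x)
  have hlim : Tendsto (fun n => ∫ x, u x * trunc n (v x)) atTop (𝓝 ⟪ζ, wjet s v k⟫) :=
    ((tendsto_const_nhds (x := ζ)).inner hjet).congr fun n => (hstep n).symm
  have hint (n : ℕ) : Integrable (fun x => u x * trunc n (v x)) :=
    hu.mul_bdd (htm n) (ae_of_all _ fun x => abs_trunc_le n (v x))
  -- The majorant must be nonnegative: `u v ≤ P` and `0 ≤ P` give `θ u v ≤ P` for every `θ ∈ [0,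
  -- 1]`, which may fail for `R` itself.
  set P : Torus L d → ℝ := fun x => max (R x) 0 with hP
  have hPi : Integrable P := hR.pos_part
  have hnn (n : ℕ) : ∀ᵐ x, 0 ≤ P x - u x * trunc n (v x) := by
    filter_upwards [hle] with x hx
    obtain ⟨θ, h0, h1, h2⟩ := exists_trunc_eq n (v x)
    have e : u x * trunc n (v x) = θ * (u x * v x) := by rw [h2]; ring
    have hm : u x * v x ≤ P x := hx.trans (le_max_left _ _)
    have hm0 : 0 ≤ P x := le_max_right _ _
    rw [e]
    nlinarith
  have huv : AEStronglyMeasurable (fun x => u x * v x) volume := hu.1.mul hv.memLp.1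
  have hnn' : ∀ᵐ x, 0 ≤ P x - u x * v x := by
    filter_upwards [hle] with x hx
    have : u x * v x ≤ P x := hx.trans (le_max_left _ _)
    linarith
  -- Fatou's lemma needs only the one-sided bound; the integrals of the truncated products converge
  -- because they equal pairings with convergent jets.
  have hfatou : ∫⁻ x, ENNReal.ofReal (P x - u x * v x) ≤
      ENNReal.ofReal ((∫ x, P x) - ⟪ζ, wjet s v k⟫) := by
    calc ∫⁻ x, ENNReal.ofReal (P x - u x * v x)
        = ∫⁻ x, liminf (fun n => ENNReal.ofReal (P x - u x * trunc n (v x))) atTop := by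
          congr 1; ext x
          refine (Tendsto.liminf_eq ?_).symm
          exact (ENNReal.continuous_ofReal.tendsto _).comp
            (((tendsto_trunc (v x)).const_mul _).const_sub _)
      _ ≤ liminf (fun n => ∫⁻ x, ENNReal.ofReal (P x - u x * trunc n (v x))) atTop :=
          lintegral_liminf_le' fun n => (hPi.1.sub (hint n).1).aemeasurable.ennreal_ofReal
      _ = _ := by
          refine Tendsto.liminf_eq ?_
          refine ((ENNReal.continuous_ofReal.tendsto _).comp (hlim.const_sub (∫ x, P x))).congr
            fun n => ?_
          rw [Function.comp, ← integral_sub hPi (hint n),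
            ofReal_integral_eq_lintegral_ofReal (f := fun x => P x - u x * trunc n (v x))
              (hPi.sub (hint n)) (hnn n)]
  have hsub : Integrable (fun x => P x - u x * v x) :=
    ⟨hPi.1.sub huv, (hasFiniteIntegral_iff_ofReal hnn').2
      (hfatou.trans_lt ENNReal.ofReal_lt_top)⟩
  have hI : Integrable (fun x => u x * v x) := by
    have := hPi.sub hsub
    refine this.congr (ae_of_all _ fun x => ?_)
    simp
  refine ⟨hI, tendsto_nhds_unique ?_ hlim⟩
  refine tendsto_integral_of_dominated_convergence (fun x => |u x * v x|) (fun n => (hint n).1)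
    hI.abs ?_ (ae_of_all _ fun x => (tendsto_trunc (v x)).const_mul _)
  refine fun n => ae_of_all _ fun x => ?_
  rw [norm_mul, abs_mul]
  exact mul_le_mul_of_nonneg_left (habs n _) (abs_nonneg _)

lemma Represents.integral_mul_bdd (hs : IsWeight s c C) {ζ : Jets L d} {u : Torus L d → ℝ}
    (hu : Integrable u) (hζ : Represents s ζ u) {v : Torus L d → ℝ} {k : Fin d → Torus L d → ℝ}
    (hv : HasH1Grad v k) {K : ℝ} (hK : ∀ x, |v x| ≤ K) :
    ∫ x, u x * v x = ⟪ζ, wjet s v k⟫ := by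
  refine (hζ.integral_mul hs hu hv (hu.abs.mul_const K) (ae_of_all _ fun x => ?_)).2
  refine (le_abs_self _).trans ?_
  rw [abs_mul]
  exact mul_le_mul_of_nonneg_left (hK x) (abs_nonneg _)

end Weight

end GrandCanonical

/-! ### Abstract variational lemmas. -/

/-- Existence of proximal points of a midpoint convex, closed, nonnegative functional, with a
quantitative minimality. -/
lemma exists_proximal_point {X : Type*} [NormedAddCommGroup X] [InnerProductSpace ℝ X]
    [CompleteSpace X] {S : Set X} {f : X → ℝ} (hne : S.Nonempty) (hf0 : ∀ x ∈ S, 0 ≤ f x)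
    (hmid : ∀ x ∈ S, ∀ y ∈ S, (1 / 2 : ℝ) • (x + y) ∈ S ∧
      f ((1 / 2 : ℝ) • (x + y)) ≤ (f x + f y) / 2)
    (hclosed : ∀ (x : ℕ → X) (p : X) (c : ℝ), (∀ n, x n ∈ S) → Tendsto x atTop (𝓝 p) →
      Tendsto (fun n => f (x n)) atTop (𝓝 c) → p ∈ S ∧ f p ≤ c)
    {h : ℝ} (hh : 0 < h) (a : X) :
    ∃ p ∈ S, ∀ y ∈ S, f p + h / 2 * ‖p - a‖ ^ 2 + h / 4 * ‖y - p‖ ^ 2 ≤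
      f y + h / 2 * ‖y - a‖ ^ 2 := by
  set E : X → ℝ := fun x => f x + h / 2 * ‖x - a‖ ^ 2 with hE
  have hE0 : ∀ x ∈ S, 0 ≤ E x := fun x hx => add_nonneg (hf0 x hx) (by positivity)
  set m := sInf (E '' S) with hm
  have hbdd : BddBelow (E '' S) := ⟨0, by rintro _ ⟨x, hx, rfl⟩; exact hE0 x hx⟩
  have hmle : ∀ x ∈ S, m ≤ E x := fun x hx => csInf_le hbdd ⟨x, hx, rfl⟩
  have hpar (x y : X) : ‖(1 / 2 : ℝ) • (x + y) - a‖ ^ 2 =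
      (‖x - a‖ ^ 2 + ‖y - a‖ ^ 2) / 2 - ‖x - y‖ ^ 2 / 4 := by
    have e1 : (1 / 2 : ℝ) • (x + y) - a = (1 / 2 : ℝ) • ((x - a) + (y - a)) := by
      module
    have e2 : x - y = (x - a) - (y - a) := by abel
    rw [e1, e2, norm_smul, mul_pow, norm_add_sq_real, norm_sub_sq_real (x - a) (y - a)]
    norm_num
    ring
  -- The parallelogram identity makes `E` strongly midpoint convex. This one inequality makes
  -- minimizing sequences Cauchy and, applied with one point equal to the minimizer, yields the
  -- quantitative gap `h / 4`.
  have hgap : ∀ x ∈ S, ∀ y ∈ S, m + h / 8 * ‖x - y‖ ^ 2 ≤ (E x + E y) / 2 := by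
    intro x hx y hy
    have h1 := hmle _ (hmid x hx y hy).1
    have h2 := (hmid x hx y hy).2
    simp only [hE] at h1 ⊢
    rw [hpar] at h1
    linarith
  obtain ⟨v, hv_anti, hv_lim, hv_mem⟩ := exists_seq_tendsto_sInf (hne.image E) hbdd
  choose x hxS hxE using hv_mem
  have hElim : Tendsto (fun n => E (x n)) atTop (𝓝 m) := by
    simpa only [hxE] using hv_lim
  have hcauchy : CauchySeq x := by
    refine Metric.cauchySeq_iff'.2 fun ε hε => ?_
    have hev : ∀ᶠ n in atTop, E (x n) < m + h / 8 * ε ^ 2 :=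
      hElim.eventually_lt_const (by linarith [show 0 < h / 8 * ε ^ 2 by positivity])
    obtain ⟨N, hN⟩ := eventually_atTop.1 hev
    refine ⟨N, fun n hn => ?_⟩
    have h1 := hgap _ (hxS n) _ (hxS N)
    have h2 := hN n hn
    have h3 := hN N le_rfl
    rw [dist_eq_norm]
    have h4 : h / 8 * ‖x n - x N‖ ^ 2 < h / 8 * ε ^ 2 := by linarith
    exact lt_of_pow_lt_pow_left₀ 2 hε.le (lt_of_mul_lt_mul_left h4 (by positivity))
  obtain ⟨p, hp⟩ := cauchySeq_tendsto_of_complete hcauchy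
  have hflim : Tendsto (fun n => f (x n)) atTop (𝓝 (m - h / 2 * ‖p - a‖ ^ 2)) := by
    have := hElim.sub (((hp.sub_const a).norm.pow 2).const_mul (h / 2))
    refine this.congr fun n => ?_
    simp [hE]
  obtain ⟨hpS, hfp⟩ := hclosed x p _ hxS hp hflim
  refine ⟨p, hpS, fun y hy => ?_⟩
  have h1 := hgap y hy p hpS
  have h2 : E p ≤ m := by simp only [hE]; linarith
  have h3 : m ≤ E p := hmle p hpS
  change E p + h / 4 * ‖y - p‖ ^ 2 ≤ E y
  linarith

/-- For small `t` of the sign opposite to `A` the linear term dominates; this extracts a first-order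
condition from a quadratic upper bound. -/
lemma eq_zero_of_forall_quadratic_nonneg {A B δ : ℝ} (hδ : 0 < δ)
    (h : ∀ t, |t| ≤ δ → 0 ≤ t * A + t ^ 2 * B) : A = 0 := by
  by_contra hA
  have hApos : 0 < |A| := abs_pos.2 hA
  -- With this choice `r |B| ≤ |A| / 2`, whereas nonnegativity at `r` and `-r` forces `|A| ≤ r |B|`.
  set r := min δ (|A| / (2 * (|B| + 1)))
  have hr : 0 < r := lt_min hδ (by positivity)
  have h1 := h r (by rw [abs_of_pos hr]; exact min_le_left _ _)
  have h2 := h (-r) (by rw [abs_neg, abs_of_pos hr]; exact min_le_left _ _)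
  have h3 : r * (2 * (|B| + 1)) ≤ |A| := (le_div_iff₀ (by positivity)).1 (min_le_right _ _)
  have h4 : r * |A| ≤ r ^ 2 * B := by
    rcases abs_cases A with ⟨e, _⟩ | ⟨e, _⟩ <;> rw [e] <;> nlinarith
  have h5 : r * |A| ≤ r * (r * |B|) := by
    refine h4.trans ?_
    have := mul_le_mul_of_nonneg_left (le_abs_self B) (sq_nonneg r)
    nlinarith
  have h6 := le_of_mul_le_mul_left h5 hr
  nlinarith [abs_nonneg B]

/-! ### Estimates in the weighted inner product. -/

namespace GrandCanonical

variable {L : ℝ} [Fact (0 < L)] {d : ℕ}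

lemma HasH1Grad.add {f f' : Torus L d → ℝ} {g g' : Fin d → Torus L d → ℝ} (h : HasH1Grad f g)
    (h' : HasH1Grad f' g') : HasH1Grad (fun x => f x + f' x) (fun i x => g i x + g' i x) where
  memLp := h.memLp.add h'.memLp
  memLp_grad i := (h.memLp_grad i).add (h'.memLp_grad i)
  weak i ψ hψ := by
    have hψ2 := memLp_of_continuous hψ.continuous 2
    have hdψ2 := memLp_of_continuous (hψ.isCk.continuous_pderiv i) 2
    simp_rw [add_mul]
    have i1 : Integrable fun x => f x * pderiv i ψ x := h.memLp.integrable_mul hdψ2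
    have i2 : Integrable fun x => f' x * pderiv i ψ x := h'.memLp.integrable_mul hdψ2
    have i3 : Integrable fun x => g i x * ψ x := (h.memLp_grad i).integrable_mul hψ2
    have i4 : Integrable fun x => g' i x * ψ x := (h'.memLp_grad i).integrable_mul hψ2
    rw [integral_add i1 i2, integral_add i3 i4, h.weak i ψ hψ, h'.weak i ψ hψ]
    ring

lemma hasH1Grad_const (a : ℝ) :
    HasH1Grad (fun _ : Torus L d => a) (fun _ _ => 0) := by
  refine (IsCk.hasH1Grad (isCk_const a)).congr EventuallyEq.rfl fun i => ?_
  exact ae_of_all _ fun x => pderiv_const a i x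

section Weight

variable {s : Option (Fin d) → Torus L d → ℝ} {c C : ℝ}

lemma inner_wjet (hs : IsWeight s c C) {f f' : Torus L d → ℝ} {g g' : Fin d → Torus L d → ℝ}
    (h : ∀ o, MemLp (pair f g o) 2 volume) (h' : ∀ o, MemLp (pair f' g' o) 2 volume) :
    ⟪wjet s f g, wjet s f' g'⟫ =
      ∑ o, ∫ x, s o x * pair f g o x * (s o x * pair f' g' o x) :=
  inner_toJet_toJet (fun o => hs.memLp_mul (h o) o) fun o => hs.memLp_mul (h' o) o

lemma wjet_add (hs : IsWeight s c C) {f f' : Torus L d → ℝ} {g g' : Fin d → Torus L d → ℝ}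
    (h : ∀ o, MemLp (pair f g o) 2 volume) (h' : ∀ o, MemLp (pair f' g' o) 2 volume) :
    wjet s (fun x => f x + f' x) (fun i x => g i x + g' i x) = wjet s f g + wjet s f' g' := by
  unfold wjet
  rw [← toJet_add (fun o => hs.memLp_mul (h o) o) fun o => hs.memLp_mul (h' o) o]
  congr 1; funext o x
  cases o <;> simp [pair, mul_add]

/-- The torus has finite volume and the weights are bounded, so a uniform bound on the components
controls the weighted `H^1` norm. -/
lemma norm_wjet_le (hs : IsWeight s c C) :
    ∃ A : ℝ, 0 ≤ A ∧ ∀ (f : Torus L d → ℝ) (g : Fin d → Torus L d → ℝ) (K : ℝ), 0 ≤ K →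
      Continuous f → (∀ i, Continuous (g i)) → (∀ x, |f x| ≤ K) → (∀ i x, |g i x| ≤ K) →
      ‖wjet s f g‖ ≤ A * K := by
  set V := (volume : Measure (Torus L d)).real Set.univ
  refine ⟨√((d + 1) * (C ^ 2 * V)), Real.sqrt_nonneg _, fun f g K hK hf hg hfK hgK => ?_⟩
  have hm (o) : MemLp (pair f g o) 2 volume := by
    cases o with
    | none => exact memLp_of_continuous hf 2
    | some i => exact memLp_of_continuous (hg i) 2
  have hb (o x) : |pair f g o x| ≤ K := by
    cases o with
    | none => exact hfK x
    | some i => exact hgK i x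
  have hbound (o) : ∫ x, s o x * pair f g o x * (s o x * pair f g o x) ≤ (C * K) ^ 2 * V := by
    have h1 : ∫ _ : Torus L d, (C * K) ^ 2 = (C * K) ^ 2 * V := by
      rw [integral_const, smul_eq_mul, mul_comm]
    rw [← h1]
    refine integral_mono_of_nonneg (ae_of_all _ fun x => mul_self_nonneg _) (integrable_const _)
      (ae_of_all _ fun x => ?_)
    simp only []
    rw [← abs_mul_abs_self, ← sq]
    refine pow_le_pow_left₀ (abs_nonneg _) ?_ 2
    rw [abs_mul]
    exact mul_le_mul (hs.abs_le o x) (hb o x) (abs_nonneg _) hs.upper_pos.le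
  have h2 : ‖wjet s f g‖ ^ 2 ≤ (d + 1) * ((C * K) ^ 2 * V) := by
    rw [← real_inner_self_eq_norm_sq, inner_wjet hs hm hm]
    refine (Finset.sum_le_card_nsmul _ _ _ fun o _ => hbound o).trans (le_of_eq ?_)
    simp
  have h3 : ‖wjet s f g‖ ≤ √((d + 1) * ((C * K) ^ 2 * V)) := Real.le_sqrt_of_sq_le h2
  refine h3.trans (le_of_eq ?_)
  rw [show ((d : ℝ) + 1) * ((C * K) ^ 2 * V) = (d + 1) * (C ^ 2 * V) * K ^ 2 by ring,
    Real.sqrt_mul' _ (sq_nonneg K), Real.sqrt_sq hK]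

/-- The jet of `W * u`. -/
def convJet (s : Option (Fin d) → Torus L d → ℝ) (W u : Torus L d → ℝ) : Jets L d :=
  wjet s (wConv W u) fun i => wConv (pderiv i W) u

/-- Convolution with `W` maps the dual of `H^1` to `H^1`. -/
lemma norm_convJet_le (hs : IsWeight s c C) {W : Torus L d → ℝ} (hW : IsCk 2 W) :
    ∃ A : ℝ, 0 ≤ A ∧ ∀ (u : Torus L d → ℝ) (ζ : Jets L d), Integrable u → Represents s ζ u →
      ‖convJet s W u‖ ≤ A * ‖ζ‖ := by
  obtain ⟨A, hA0, hA⟩ := norm_wjet_le hs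
  have hW1 : IsCk 1 W := hW.of_le one_le_two
  have hdW (i) : IsCk 1 (pderiv i W) := hW.pderiv (by norm_num) i
  choose K hK using fun i => exists_bound (hdW i).continuous
  choose K' hK' using fun i j => exists_bound ((hdW i).continuous_pderiv j)
  obtain ⟨K₀, hK₀, hWK⟩ := exists_bound hW.continuous
  set M := K₀ + ∑ i, K i + ∑ i, ∑ j, K' i j
  have hs1 : 0 ≤ ∑ i, K i := Finset.sum_nonneg fun i _ => (hK i).1
  have hs2 : 0 ≤ ∑ i, ∑ j, K' i j :=
    Finset.sum_nonneg fun i _ => Finset.sum_nonneg fun j _ => (hK' i j).1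
  have hM0 : 0 ≤ M := by positivity
  have hM1 (x) : |W x| ≤ M := (hWK x).trans (by linarith)
  have hM2 (i x) : |pderiv i W x| ≤ M := by
    have := Finset.single_le_sum (fun i _ => (hK i).1) (Finset.mem_univ i)
    linarith [(hK i).2 x]
  have hM3 (i j x) : |pderiv j (pderiv i W) x| ≤ M := by
    have h1 := Finset.single_le_sum (fun j _ => (hK' i j).1) (Finset.mem_univ j)
    have h2 := Finset.single_le_sum (f := fun i => ∑ j, K' i j)
      (fun i _ => Finset.sum_nonneg fun j _ => (hK' i j).1) (Finset.mem_univ i)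
    linarith [(hK' i j).2 x]
  -- The value `(k * u)(x)` is the pairing of `u` with the `C¹` function `k (x - ·)`, so it is
  -- bounded by the dual norm of `u` uniformly in `x`. Applying this to `W` and to each `∂ᵢ W`
  -- requires `W ∈ C²`.
  have key (k : Torus L d → ℝ) (hk : IsCk 1 k) (h0 : ∀ x, |k x| ≤ M)
      (h1 : ∀ j x, |pderiv j k x| ≤ M) (u : Torus L d → ℝ) (ζ : Jets L d) (hu : Integrable u)
      (hζ : Represents s ζ u) (x : Torus L d) : |wConv k u x| ≤ A * M * ‖ζ‖ := by
    have hkx := (hk.comp_sub x)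
    have h2 := hζ.integral_mul_bdd hs hu hkx.hasH1Grad (K := M) fun y => h0 _
    have h3 : wConv k u x = ∫ y, u y * k (x - y) := by
      unfold wConv; congr 1; ext y; ring
    rw [h3, h2]
    refine (abs_real_inner_le_norm _ _).trans ?_
    rw [mul_comm]
    refine mul_le_mul_of_nonneg_right ?_ (norm_nonneg _)
    refine hA _ _ M hM0 hkx.continuous (fun i => hkx.continuous_pderiv i) (fun y => h0 _) ?_
    intro i y
    rw [pderiv_comp_sub hk, abs_neg]
    exact h1 i _
  -- One factor `A` comes from pairing with the translated kernel, the other from passing from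
  -- uniform bounds on `W * u` and its gradient to the jet norm.
  refine ⟨A * (A * M), by positivity, fun u ζ hu hζ => ?_⟩
  rw [mul_assoc]
  exact hA _ _ _ (by positivity) (continuous_wConv hW.continuous hu)
    (fun i => continuous_wConv (hdW i).continuous hu)
    (key W hW1 hM1 hM2 u ζ hu hζ) fun i => key _ (hdW i) (hM2 i) (hM3 i) u ζ hu hζ

lemma convJet_sub (hs : IsWeight s c C) {W u v : Torus L d → ℝ} (hW : IsCk 1 W)
    (hu : Integrable u) (hv : Integrable v) :
    convJet s W (fun x => u x - v x) = convJet s W u - convJet s W v := by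
  unfold convJet wjet
  rw [← toJet_sub ((hasH1Grad_wConv hW hu).memLp_wpair hs) ((hasH1Grad_wConv hW hv).memLp_wpair hs)]
  congr 1; funext o x
  cases o with
  | none => simp [pair, wConv_sub hW.continuous hu hv, mul_sub]
  | some i => simp [pair, wConv_sub (hW.continuous_pderiv i) hu hv, mul_sub]

/-! ### The exponential functional and its proximal problem. -/

/-- The components of the function of which `X` is the weighted jet. -/
def unweight (s : Option (Fin d) → Torus L d → ℝ) (X : Jets L d) (o : Option (Fin d))
    (x : Torus L d) : ℝ := X o x / s o x

lemma memLp_unweight (hs : IsWeight s c C) (X : Jets L d) (o : Option (Fin d)) :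
    MemLp (unweight s X o) 2 volume := hs.memLp_div (memLp_jet X o) o

lemma pair_eta (F : Option (Fin d) → Torus L d → ℝ) :
    pair (F none) (fun i => F (some i)) = F := by
  funext o; cases o <;> rfl

lemma wjet_unweight (hs : IsWeight s c C) (X : Jets L d) :
    wjet s (unweight s X none) (fun i => unweight s X (some i)) = X := by
  rw [wjet, pair_eta]
  refine (congrArg toJet ?_).trans (toJet_coe X)
  funext o x
  rw [unweight, mul_div_cancel₀ _ (hs.pos_apply o x).ne']

lemma unweight_wjet (hs : IsWeight s c C) {f : Torus L d → ℝ} {g : Fin d → Torus L d → ℝ}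
    (h : ∀ o, MemLp (pair f g o) 2 volume) (o : Option (Fin d)) :
    unweight s (wjet s f g) o =ᵐ[volume] pair f g o := by
  filter_upwards [coeFn_toJet (fun o => hs.memLp_mul (h o) o) o] with x hx
  rw [unweight, wjet, hx, mul_div_cancel_left₀ _ (hs.pos_apply o x).ne']

/-- The closed subspace of the weighted jets of `H^1` functions. -/
def weightedJets (s : Option (Fin d) → Torus L d → ℝ) : Submodule ℝ (Jets L d) :=
  (Submodule.span ℝ {Y | ∃ i ψ, IsTest ψ ∧ Y = toJet fun o x => weakJet i ψ o x / s o x})ᗮ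

lemma mem_weightedJets (hs : IsWeight s c C) {X : Jets L d} : X ∈ weightedJets s ↔
    HasH1Grad (unweight s X none) fun i => unweight s X (some i) := by
  have hin (i : Fin d) (ψ : Torus L d → ℝ) (hψ : IsTest ψ) :
      ⟪X, toJet fun o x => weakJet i ψ o x / s o x⟫ =
        (∫ x, unweight s X none x * pderiv i ψ x) + ∫ x, unweight s X (some i) x * ψ x := by
    rw [inner_toJet X fun o => hs.memLp_div (memLp_weakJet hψ i o) o, Fintype.sum_option,
      Finset.sum_eq_single i]
    · congr 1
      · congr 1; ext x; simp only [weakJet, pair, unweight]; ring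
      · congr 1; ext x; simp only [weakJet, pair, unweight, if_true]; ring
    · intro j _ hj
      simp [weakJet, pair, hj]
    · simp
  rw [weightedJets, Submodule.mem_orthogonal']
  constructor
  · intro h
    refine ⟨memLp_unweight hs X none, fun i => memLp_unweight hs X (some i), fun i ψ hψ => ?_⟩
    have := h _ (Submodule.subset_span ⟨i, ψ, hψ, rfl⟩)
    rw [hin i ψ hψ] at this
    linarith
  · intro h Y hY
    induction hY using Submodule.span_induction with
    | mem Y hY =>
      obtain ⟨i, ψ, hψ, rfl⟩ := hY
      rw [hin i ψ hψ, h.weak i ψ hψ]; ring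
    | zero => simp
    | add Y Z _ _ hY hZ => rw [inner_add_right, hY, hZ, add_zero]
    | smul c Y _ hY => rw [inner_smul_right, hY, mul_zero]

lemma wjet_mem_weightedJets (hs : IsWeight s c C) {f : Torus L d → ℝ}
    {g : Fin d → Torus L d → ℝ} (h : HasH1Grad f g) : wjet s f g ∈ weightedJets s :=
  (mem_weightedJets hs).2 (h.congr (unweight_wjet hs h.memLp_pair none).symm
    fun i => (unweight_wjet hs h.memLp_pair (some i)).symm)

/-- The weighted jets of the `H^1` functions with integrable exponential. -/
def expDomain (s : Option (Fin d) → Torus L d → ℝ) : Set (Jets L d) :=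
  {X | X ∈ weightedJets s ∧ Integrable fun x => Real.exp (unweight s X none x)}

lemma aestronglyMeasurable_exp_unweight (hs : IsWeight s c C) (X : Jets L d) :
    AEStronglyMeasurable (fun x => Real.exp (unweight s X none x)) volume :=
  Real.continuous_exp.comp_aestronglyMeasurable (memLp_unweight hs X none).1

lemma expDomain_nonempty (hs : IsWeight s c C) : (expDomain s).Nonempty := by
  refine ⟨wjet s (fun _ => 0) (fun _ _ => 0), wjet_mem_weightedJets hs (hasH1Grad_const 0), ?_⟩
  refine (integrable_const (1 : ℝ)).congr ?_
  filter_upwards [unweight_wjet hs (hasH1Grad_const 0).memLp_pair none] with x hx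
  rw [hx]; simp [pair]

/-- Pointwise convexity of `exp` gives both the inequality and the integrable majorant that puts the
midpoint in the domain. -/
lemma expDomain_midpoint (hs : IsWeight s c C) (X Y : Jets L d) (hX : X ∈ expDomain s)
    (hY : Y ∈ expDomain s) : (1 / 2 : ℝ) • (X + Y) ∈ expDomain s ∧
      ∫ x, Real.exp (unweight s ((1 / 2 : ℝ) • (X + Y)) none x) ≤
        ((∫ x, Real.exp (unweight s X none x)) + ∫ x, Real.exp (unweight s Y none x)) / 2 := by
  have hle : ∀ᵐ x, Real.exp (unweight s ((1 / 2 : ℝ) • (X + Y)) none x) ≤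
      (Real.exp (unweight s X none x) + Real.exp (unweight s Y none x)) / 2 := by
    filter_upwards [jet_smul_apply (1 / 2) (X + Y) none, jet_add_apply X Y none] with x h1 h2
    have h3 : unweight s ((1 / 2 : ℝ) • (X + Y)) none x =
        (1 / 2 : ℝ) • unweight s X none x + (1 / 2 : ℝ) • unweight s Y none x := by
      simp only [unweight, h1, h2, smul_eq_mul]; ring
    rw [h3]
    refine (convexOn_exp.2 (Set.mem_univ _) (Set.mem_univ _) (by norm_num) (by norm_num)
      (by norm_num)).trans (le_of_eq ?_)
    simp only [smul_eq_mul]; ring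
  have hI := (hX.2.add hY.2).div_const 2
  refine ⟨⟨Submodule.smul_mem _ _ (Submodule.add_mem _ hX.1 hY.1), hI.mono'
    (aestronglyMeasurable_exp_unweight hs _) ?_⟩, ?_⟩
  · filter_upwards [hle] with x hx
    rw [Real.norm_of_nonneg (Real.exp_pos _).le]; exact hx
  · rw [← integral_add hX.2 hY.2, ← integral_div]
    exact integral_mono_of_nonneg (ae_of_all _ fun x => (Real.exp_pos _).le) hI hle

/-- Lower semicontinuity by Fatou's lemma along an almost everywhere convergent subsequence; the
finite limit of the integrals is what makes the limiting exponential integrable. -/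
lemma expDomain_closed (hs : IsWeight s c C) (X : ℕ → Jets L d) (p : Jets L d) (e : ℝ)
    (hX : ∀ n, X n ∈ expDomain s) (hlim : Tendsto X atTop (𝓝 p))
    (he : Tendsto (fun n => ∫ x, Real.exp (unweight s (X n) none x)) atTop (𝓝 e)) :
    p ∈ expDomain s ∧ ∫ x, Real.exp (unweight s p none x) ≤ e := by
  have hp : p ∈ weightedJets s :=
    (Submodule.isClosed_orthogonal _).mem_of_tendsto hlim (Eventually.of_forall fun n => (hX n).1)
  have he0 : 0 ≤ e := ge_of_tendsto' he fun n => integral_nonneg fun x => (Real.exp_pos _).le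
  have hmeas : TendstoInMeasure volume (fun n => X n none) atTop (p none) :=
    tendstoInMeasure_of_tendsto_eLpNorm (by norm_num) (fun n => (memLp_jet (X n) none).1)
      (memLp_jet p none).1 (tendsto_jets_iff.1 hlim none)
  obtain ⟨ns, hns, hae⟩ := hmeas.exists_seq_tendsto_ae
  have hfatou : ∫⁻ x, ENNReal.ofReal (Real.exp (unweight s p none x)) ≤ ENNReal.ofReal e := by
    calc ∫⁻ x, ENNReal.ofReal (Real.exp (unweight s p none x))
        = ∫⁻ x, liminf (fun n => ENNReal.ofReal (Real.exp (unweight s (X (ns n)) none x))) atTop := by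
          refine lintegral_congr_ae ?_
          filter_upwards [hae] with x hx
          refine (Tendsto.liminf_eq ?_).symm
          exact (ENNReal.continuous_ofReal.tendsto _).comp
            ((Real.continuous_exp.tendsto _).comp (hx.div_const _))
      _ ≤ liminf (fun n => ∫⁻ x, ENNReal.ofReal (Real.exp (unweight s (X (ns n)) none x))) atTop :=
          lintegral_liminf_le' fun n =>
            (aestronglyMeasurable_exp_unweight hs _).aemeasurable.ennreal_ofReal
      _ = _ := by
          refine Tendsto.liminf_eq ?_
          refine ((ENNReal.continuous_ofReal.tendsto _).comp (he.comp hns.tendsto_atTop)).congr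
            fun n => ?_
          exact ofReal_integral_eq_lintegral_ofReal (hX (ns n)).2
            (ae_of_all _ fun x => (Real.exp_pos _).le)
  have hI : Integrable fun x => Real.exp (unweight s p none x) :=
    ⟨aestronglyMeasurable_exp_unweight hs _, (hasFiniteIntegral_iff_ofReal
      (ae_of_all _ fun x => (Real.exp_pos _).le)).2 (hfatou.trans_lt ENNReal.ofReal_lt_top)⟩
  refine ⟨⟨hp, hI⟩, ?_⟩
  rw [← ofReal_integral_eq_lintegral_ofReal hI (ae_of_all _ fun x => (Real.exp_pos _).le)] at hfatou
  exact (ENNReal.ofReal_le_ofReal_iff he0).1 hfatou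

/-- The Euler–Lagrange equation of the proximal problem. -/
lemma represents_of_proximal (hs : IsWeight s c C) {h : ℝ} {a p : Jets L d}
    (hp : p ∈ expDomain s)
    (hmin : ∀ Y ∈ expDomain s, (∫ x, Real.exp (unweight s p none x)) + h / 2 * ‖p - a‖ ^ 2 ≤
      (∫ x, Real.exp (unweight s Y none x)) + h / 2 * ‖Y - a‖ ^ 2) :
    Represents s (h • (a - p)) fun x => Real.exp (unweight s p none x) := by
  intro ψ hψ
  obtain ⟨K, hK0, hK⟩ := exists_bound hψ.continuous
  set w := wjet s ψ fun i => pderiv i ψ with hw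
  set v := unweight s p none with hv
  have hψm := hψ.continuous.aestronglyMeasurable (μ := (volume : Measure (Torus L d)))
  have hval (t : ℝ) : ∀ᵐ x, unweight s (p + t • w) none x = v x + t * ψ x := by
    filter_upwards [jet_add_apply p (t • w) none, jet_smul_apply t w none,
      unweight_wjet hs (memLp_pair_test hψ) none] with x h1 h2 h3
    have h4 : unweight s w none x = ψ x := h3
    rw [unweight] at h4
    rw [unweight, h1, h2, add_div, mul_div_assoc, h4]
    rfl
  have i1 : Integrable fun x => Real.exp (v x) * ψ x :=
    hp.2.mul_bdd hψm (ae_of_all _ hK)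
  have i2 : Integrable fun x => Real.exp (v x) * ψ x ^ 2 := by
    refine hp.2.mul_bdd (c := K ^ 2) (hψm.pow 2) (ae_of_all _ fun x => ?_)
    rw [norm_pow]
    exact pow_le_pow_left₀ (norm_nonneg _) (hK x) 2
  have hA : (∫ x, Real.exp (v x) * ψ x) + h * ⟪p - a, w⟫ = 0 := by
    -- The range of `t` ensures `|t ψ| ≤ 1`, where `e^y ≤ 1 + y + y²`. This bound keeps the
    -- perturbation inside `expDomain` and replaces differentiation under the integral.
    refine eq_zero_of_forall_quadratic_nonneg (δ := 1 / (K + 1)) (by positivity)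
      (B := (∫ x, Real.exp (v x) * ψ x ^ 2) + h / 2 * ‖w‖ ^ 2) fun t ht => ?_
    have hle : ∀ᵐ x, Real.exp (unweight s (p + t • w) none x) ≤
        Real.exp (v x) + t * (Real.exp (v x) * ψ x) + t ^ 2 * (Real.exp (v x) * ψ x ^ 2) := by
      filter_upwards [hval t] with x hx
      have h1 : |t * ψ x| ≤ 1 := by
        rw [abs_mul]
        calc |t| * |ψ x| ≤ 1 / (K + 1) * K := mul_le_mul ht (hK x) (abs_nonneg _) (by positivity)
          _ ≤ 1 := by rw [div_mul_eq_mul_div, one_mul, div_le_one (by positivity)]; linarith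
      have h2 := (abs_le.1 (Real.abs_exp_sub_one_sub_id_le h1)).2
      rw [hx, Real.exp_add]
      have h3 := mul_le_mul_of_nonneg_left h2 (Real.exp_pos (v x)).le
      nlinarith
    have hI : Integrable fun x => Real.exp (v x) + t * (Real.exp (v x) * ψ x) +
        t ^ 2 * (Real.exp (v x) * ψ x ^ 2) :=
      (hp.2.add (i1.const_mul t)).add (i2.const_mul (t ^ 2))
    have hmem : p + t • w ∈ expDomain s := by
      refine ⟨Submodule.add_mem _ hp.1 (Submodule.smul_mem _ _
        (wjet_mem_weightedJets hs hψ.isCk.hasH1Grad)), hI.mono'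
        (aestronglyMeasurable_exp_unweight hs _) ?_⟩
      filter_upwards [hle] with x hx
      rw [Real.norm_of_nonneg (Real.exp_pos _).le]; exact hx
    have h1 := hmin _ hmem
    have h2 : ∫ x, Real.exp (unweight s (p + t • w) none x) ≤
        (∫ x, Real.exp (v x)) + t * (∫ x, Real.exp (v x) * ψ x) +
          t ^ 2 * ∫ x, Real.exp (v x) * ψ x ^ 2 := by
      refine (integral_mono_of_nonneg (ae_of_all _ fun x => (Real.exp_pos _).le) hI hle).trans
        (le_of_eq ?_)
      have e1 := integral_add (hp.2.add (i1.const_mul t)) (i2.const_mul (t ^ 2))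
      have e2 := integral_add hp.2 (i1.const_mul t)
      simp only [Pi.add_apply] at e1 e2
      rw [e1, e2, integral_const_mul, integral_const_mul]
    have h3 : ‖p + t • w - a‖ ^ 2 = ‖p - a‖ ^ 2 + 2 * (t * ⟪p - a, w⟫) + t ^ 2 * ‖w‖ ^ 2 := by
      rw [show p + t • w - a = (p - a) + t • w by abel, norm_add_sq_real, inner_smul_right,
        norm_smul, mul_pow, Real.norm_eq_abs, sq_abs]
    rw [h3] at h1
    nlinarith
  rw [inner_smul_left, ← neg_sub p a, inner_neg_left]
  simp only [conj_trivial]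
  linarith

/-- The solution operator of `e^φ + h B φ = h B a`. -/
lemma exists_solution_operator (hs : IsWeight s c C) {h : ℝ} (hh : 0 < h) :
    ∃ P : Jets L d → Jets L d, (∀ a, P a ∈ expDomain s) ∧
      (∀ a, Represents s (h • (a - P a)) fun x => Real.exp (unweight s (P a) none x)) ∧
      ∀ a b, ‖P a - P b‖ ≤ 2 * ‖a - b‖ := by
  have hex := exists_proximal_point (S := expDomain s)
    (f := fun X => ∫ x, Real.exp (unweight s X none x)) (expDomain_nonempty hs)
    (fun X _ => integral_nonneg fun x => (Real.exp_pos _).le)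
    (fun X hX Y hY => expDomain_midpoint hs X Y hX hY) (expDomain_closed hs) hh
  choose P hP hmin using hex
  refine ⟨P, hP, fun a => represents_of_proximal hs (hP a) fun Y hY => ?_, fun a b => ?_⟩
  · have := hmin a Y hY
    have h2 : 0 ≤ h / 4 * ‖Y - P a‖ ^ 2 := by positivity
    linarith
  · have h1 := hmin a _ (hP b)
    have h2 := hmin b _ (hP a)
    set p := P a
    set q := P b
    -- Adding the two minimality inequalities cancels the exponential integrals and leaves `‖p - q‖²
    -- ≤ 2 ⟪p - q, a - b⟫`.
    have e1 : ‖q - a‖ ^ 2 - ‖p - a‖ ^ 2 + ‖p - b‖ ^ 2 - ‖q - b‖ ^ 2 = 2 * ⟪p - q, a - b⟫ := by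
      simp only [← real_inner_self_eq_norm_sq, inner_sub_left, inner_sub_right]
      rw [real_inner_comm a q, real_inner_comm a p, real_inner_comm b p, real_inner_comm b q]
      ring
    have e2 : ‖q - p‖ = ‖p - q‖ := norm_sub_rev _ _
    rw [e2] at h1
    have h3 : h * ‖p - q‖ ^ 2 ≤ h * (2 * ⟪p - q, a - b⟫) := by
      rw [← e1]; linarith
    have h4 := le_of_mul_le_mul_left h3 hh
    have h5 := real_inner_le_norm (p - q) (a - b)
    by_contra hlt
    push Not at hlt
    have h6 : 0 < ‖p - q‖ := lt_of_le_of_lt (by positivity) hlt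
    nlinarith

/-- Existence for the discrete equation, in terms of jets. -/
lemma exists_represents (hs : IsWeight s c C) {W : Torus L d → ℝ} (hW : IsCk 2 W) (μ : ℝ)
    {N₀ : Torus L d → ℝ} (hN₀ : Continuous N₀) {A : ℝ} (hA0 : 0 ≤ A)
    (hA : ∀ (u : Torus L d → ℝ) (ζ : Jets L d), Integrable u → Represents s ζ u →
      ‖convJet s W u‖ ≤ A * ‖ζ‖) {h : ℝ} (hh : 0 < h) (hsmall : 6 * h * A ≤ 1) :
    ∃ (φ : Torus L d → ℝ) (g : Fin d → Torus L d → ℝ), HasH1Grad φ g ∧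
      Integrable (fun x => Real.exp (φ x)) ∧
      Represents s (-(h • wjet s (fun x => φ x + -μ + wConv W (fun x => Real.exp (φ x)) x)
        fun i x => g i x + 0 + wConv (pderiv i W) (fun x => Real.exp (φ x)) x))
        fun x => Real.exp (φ x) - N₀ x := by
  have hW1 : IsCk 1 W := hW.of_le one_le_two
  obtain ⟨P, hP, hrep, hlip⟩ := exists_solution_operator hs hh
  have hZm (o) : MemLp (pair (fun x => N₀ x / s none x) (fun (_ : Fin d) _ => (0 : ℝ)) o) 2
      volume := by
    cases o with
    | none => exact hs.memLp_div (memLp_of_continuous hN₀ 2) none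
    | some i => simp [pair]
  -- A jet representing `N₀` through its value component alone. It need not be the weighted jet of
  -- an `H^1` function; the proximal problem accepts any jet as its centre.
  set Z := toJet (pair (fun x => N₀ x / s none x) fun (_ : Fin d) _ => (0 : ℝ)) with hZ
  have hZrep : Represents s Z N₀ := by
    intro ψ hψ
    rw [hZ, wjet, inner_toJet_toJet hZm (hψ.isCk.hasH1Grad.memLp_wpair hs), Fintype.sum_option]
    simp only [pair, zero_mul, integral_zero, Finset.sum_const_zero, add_zero]
    congr 1; ext x
    have := (hs.pos_apply none x).ne'
    field_simp
  set M := wjet s (fun _ => μ) fun (_ : Fin d) _ => (0 : ℝ) with hM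
  -- With this centre, `e^φ = h B (a - φ)` becomes `e^φ - N₀ = -h B (φ - μ + w)`, which is the
  -- discrete equation once `w = W * e^φ`.
  set a : Jets L d → Jets L d := fun w => M + h⁻¹ • Z - w with ha
  set N : Jets L d → Torus L d → ℝ := fun w x => Real.exp (unweight s (P (a w)) none x) with hN
  have hNi (w) : Integrable (N w) := (hP (a w)).2
  -- Since `P` is `2`-Lipschitz, `h (a - P a)` is `3h`-Lipschitz in `w`; convolution contributes the
  -- factor `A`, and `3 h A ≤ 1 / 2` is the smallness assumption.
  have hcontr : ContractingWith (1 / 2) fun w => convJet s W (N w) := by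
    refine ⟨by norm_num, LipschitzWith.of_dist_le_mul fun w w' => ?_⟩
    rw [dist_eq_norm, dist_eq_norm, ← convJet_sub hs hW1 (hNi w) (hNi w')]
    refine (hA _ _ ((hNi w).sub (hNi w'))
      ((hrep (a w)).sub (hNi w) (hNi w') (hrep (a w')))).trans ?_
    have e : a w - a w' = -(w - w') := by simp only [ha]; abel
    have h1 := hlip (a w) (a w')
    rw [e, norm_neg] at h1
    have h2 : ‖h • (a w - P (a w)) - h • (a w' - P (a w'))‖ ≤ h * (3 * ‖w - w'‖) := by
      rw [← smul_sub, norm_smul, Real.norm_of_nonneg hh.le]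
      refine mul_le_mul_of_nonneg_left ?_ hh.le
      rw [show a w - P (a w) - (a w' - P (a w')) = (a w - a w') - (P (a w) - P (a w')) by abel, e]
      refine (norm_sub_le _ _).trans ?_
      rw [norm_neg]; linarith
    refine (mul_le_mul_of_nonneg_left h2 hA0).trans ?_
    have h3 : ((1 / 2 : NNReal) : ℝ) = 1 / 2 := by norm_num
    rw [h3]
    nlinarith [norm_nonneg (w - w')]
  set w := hcontr.fixedPoint _
  have hw : convJet s W (N w) = w := hcontr.fixedPoint_isFixedPt
  set p := P (a w) with hp
  have hpH := (mem_weightedJets hs).1 (hP (a w)).1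
  refine ⟨unweight s p none, fun i => unweight s p (some i), hpH, hNi w, ?_⟩
  have hr := (hrep (a w)).sub (hNi w) (integrable_of_continuous hN₀) hZrep
  convert hr using 1
  have hmμ := hasH1Grad_const (L := L) (d := d) (-μ)
  have hconv := hasH1Grad_wConv hW1 (hNi w)
  rw [wjet_add hs (hpH.add hmμ).memLp_pair hconv.memLp_pair,
    wjet_add hs hpH.memLp_pair hmμ.memLp_pair, wjet_unweight hs]
  have e1 : wjet s (fun _ => -μ) (fun (_ : Fin d) _ => (0 : ℝ)) = -M := by
    rw [hM, wjet, wjet, ← neg_one_smul ℝ (toJet _),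
      ← toJet_smul (-1) ((hasH1Grad_const μ).memLp_wpair hs)]
    congr 1; funext o x
    cases o <;> simp [pair]
  have e2 : wjet s (wConv W (N w)) (fun i => wConv (pderiv i W) (N w)) = w := hw
  rw [e1, e2]
  change -(h • (p + -M + w)) = h • (M + h⁻¹ • Z - w - p) - Z
  have e3 : h • h⁻¹ • Z = Z := smul_inv_smul₀ hh.ne' Z
  simp only [smul_sub, smul_add, e3, smul_neg]
  abel

end Weight

end GrandCanonical

/-! ### The weight `Ω` and the inner product attached to `N₀`. -/

lemma Real.exp_sub_one_div_bounds {x : ℝ} (hx : x ≠ 0) :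
    Real.exp (-|x|) ≤ (Real.exp x - 1) / x ∧ (Real.exp x - 1) / x ≤ Real.exp |x| := by
  have h1 := Real.add_one_le_exp x
  have h2 := Real.add_one_le_exp (-x)
  have h3 : Real.exp x * Real.exp (-x) = 1 := by rw [← Real.exp_add]; simp
  have h4 := Real.exp_pos x
  have h5 := Real.exp_pos (-x)
  rcases lt_or_gt_of_ne hx with h | h
  · rw [abs_of_neg h, neg_neg]
    rw [le_div_iff_of_neg h, div_le_iff_of_neg h]
    constructor
    · nlinarith
    · nlinarith
  · rw [abs_of_pos h, le_div_iff₀ h, div_le_iff₀ h]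
    constructor
    · have : Real.exp (-x) ≤ 1 := Real.exp_le_one_iff.2 (by linarith)
      nlinarith
    · nlinarith

namespace GrandCanonical

variable {L : ℝ} [Fact (0 < L)] {d : ℕ}

/-- For `Φ ≠ 0` one has `Ω = e^{(μ - w)/2} (e^Φ - 1) / Φ`, and the quotient lies between `e^{-|Φ|}`
and `e^{|Φ|}`; the value `√N₀` at `Φ = 0` fits the same bounds. Since `Φ_{N₀}` is bounded, `Ω` is
bounded above and away from zero. -/
lemma Omega_bounds {W : Torus L d → ℝ} {μ : ℝ} {N₀ : Torus L d → ℝ} {x : Torus L d}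
    (hN₀ : 0 < N₀ x) :
    Real.exp ((μ - wConv W N₀ x) / 2) * Real.exp (-|Phi W μ N₀ x|) ≤ Omega W μ N₀ x ∧
      Omega W μ N₀ x ≤ Real.exp ((μ - wConv W N₀ x) / 2) * Real.exp |Phi W μ N₀ x| := by
  by_cases hΦ : Phi W μ N₀ x = 0
  · have h1 : Real.log (N₀ x) = μ - wConv W N₀ x := by
      unfold Phi at hΦ; linarith
    have h2 : Omega W μ N₀ x = Real.exp ((μ - wConv W N₀ x) / 2) := by
      rw [Omega, if_pos hΦ, ← h1, Real.exp_half, Real.exp_log hN₀]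
    rw [h2, hΦ]; simp
  · have h2 : Omega W μ N₀ x = Real.exp ((μ - wConv W N₀ x) / 2) *
        ((Real.exp (Phi W μ N₀ x) - 1) / Phi W μ N₀ x) := by
      rw [Omega, if_neg hΦ, ← mul_div_assoc]
      congr 1
      have e1 : N₀ x * Real.exp (-(1 / 2) * (μ - wConv W N₀ x)) =
          Real.exp ((μ - wConv W N₀ x) / 2) * Real.exp (Phi W μ N₀ x) := by
        nth_rewrite 1 [← Real.exp_log hN₀]
        rw [← Real.exp_add, ← Real.exp_add]
        congr 1; unfold Phi; ring
      have e2 : (1 / 2) * (μ - wConv W N₀ x) = (μ - wConv W N₀ x) / 2 := by ring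
      rw [e1, e2]; ring
    rw [h2]
    have h3 := Real.exp_sub_one_div_bounds hΦ
    exact ⟨mul_le_mul_of_nonneg_left h3.1 (Real.exp_pos _).le,
      mul_le_mul_of_nonneg_left h3.2 (Real.exp_pos _).le⟩

/-- The weights of the inner product attached to `N₀`. -/
def weight (W : Torus L d → ℝ) (μ : ℝ) (N₀ : Torus L d → ℝ) :
    Option (Fin d) → Torus L d → ℝ
  | none => fun x => √(Omega W μ N₀ x)
  | some _ => fun x => √(N₀ x)

lemma Omega_pos {W : Torus L d → ℝ} {μ : ℝ} {N₀ : Torus L d → ℝ} {x : Torus L d}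
    (hN₀ : 0 < N₀ x) : 0 < Omega W μ N₀ x :=
  lt_of_lt_of_le (by positivity) (Omega_bounds hN₀).1

lemma continuous_Phi {W : Torus L d → ℝ} (hW : Continuous W) {μ : ℝ} {N₀ : Torus L d → ℝ}
    (hN₀ : Continuous N₀) (hpos : ∀ x, 0 < N₀ x) : Continuous (Phi W μ N₀) :=
  ((hN₀.log fun x => (hpos x).ne').sub continuous_const).add
    (continuous_wConv hW (integrable_of_continuous hN₀))

lemma measurable_Omega {W : Torus L d → ℝ} (hW : Continuous W) {μ : ℝ} {N₀ : Torus L d → ℝ}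
    (hN₀ : Continuous N₀) (hpos : ∀ x, 0 < N₀ x) : Measurable (Omega W μ N₀) := by
  have h1 := continuous_Phi hW (μ := μ) hN₀ hpos
  have h2 := continuous_wConv hW (integrable_of_continuous hN₀)
  refine Measurable.ite (h1.measurable (measurableSet_singleton 0)) hN₀.sqrt.measurable ?_
  refine Measurable.div (Continuous.measurable ?_) h1.measurable
  fun_prop

lemma exists_isWeight {W : Torus L d → ℝ} (hW : Continuous W) (μ : ℝ) {N₀ : Torus L d → ℝ}
    (hN₀ : Continuous N₀) {κ : ℝ} (hκ : 0 < κ) (hle : ∀ x, κ ≤ N₀ x) :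
    ∃ c C, IsWeight (weight W μ N₀) c C := by
  have hpos (x) : 0 < N₀ x := hκ.trans_le (hle x)
  obtain ⟨K₁, -, hK₁⟩ := exists_bound (continuous_Phi hW (μ := μ) hN₀ hpos)
  obtain ⟨K₂, -, hK₂⟩ := exists_bound (f := fun x => μ - wConv W N₀ x)
    (continuous_const.sub (continuous_wConv hW (integrable_of_continuous hN₀)))
  obtain ⟨K₃, -, hK₃⟩ := exists_bound hN₀
  have hlow (x) : Real.exp (-K₂ / 2) * Real.exp (-K₁) ≤ Omega W μ N₀ x := by
    refine le_trans ?_ (Omega_bounds (hpos x)).1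
    have := (abs_le.1 (hK₂ x)).1
    exact mul_le_mul (Real.exp_le_exp.2 (by linarith)) (Real.exp_le_exp.2 (by linarith [hK₁ x]))
      (Real.exp_pos _).le (Real.exp_pos _).le
  have hup (x) : Omega W μ N₀ x ≤ Real.exp (K₂ / 2) * Real.exp K₁ := by
    refine (Omega_bounds (hpos x)).2.trans ?_
    have := (abs_le.1 (hK₂ x)).2
    exact mul_le_mul (Real.exp_le_exp.2 (by linarith)) (Real.exp_le_exp.2 (by linarith [hK₁ x]))
      (Real.exp_pos _).le (Real.exp_pos _).le
  refine ⟨min (√(Real.exp (-K₂ / 2) * Real.exp (-K₁))) (√κ),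
    max (√(Real.exp (K₂ / 2) * Real.exp K₁)) (√K₃), ?_, ?_, ?_, ?_⟩
  · rintro (_ | i)
    · exact (measurable_Omega hW hN₀ hpos).sqrt
    · exact hN₀.sqrt.measurable
  · exact lt_min (Real.sqrt_pos.2 (by positivity)) (Real.sqrt_pos.2 hκ)
  · rintro (_ | i) x
    · exact (min_le_left _ _).trans (Real.sqrt_le_sqrt (hlow x))
    · exact (min_le_right _ _).trans (Real.sqrt_le_sqrt (hle x))
  · rintro (_ | i) x
    · exact (Real.sqrt_le_sqrt (hup x)).trans (le_max_left _ _)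
    · exact (Real.sqrt_le_sqrt ((le_abs_self _).trans (hK₃ x))).trans (le_max_right _ _)

lemma energyDensity_eq_sum {W : Torus L d → ℝ} {μ : ℝ} {N₀ : Torus L d → ℝ} {x : Torus L d}
    (hpos : 0 < N₀ x) (f f' : Torus L d → ℝ) (g g' : Fin d → Torus L d → ℝ) :
    energyDensity W μ N₀ f g f' g' x = ∑ o, weight W μ N₀ o x * pair f g o x *
      (weight W μ N₀ o x * pair f' g' o x) := by
  rw [Fintype.sum_option, energyDensity, add_comm, Finset.mul_sum]
  congr 1
  · simp only [weight, pair]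
    rw [← Real.mul_self_sqrt (Omega_pos (W := W) (μ := μ) hpos).le]
    rw [Real.sqrt_mul_self (Real.sqrt_nonneg _)]
    ring
  · refine Finset.sum_congr rfl fun i _ => ?_
    simp only [weight, pair]
    nth_rewrite 1 [← Real.mul_self_sqrt hpos.le]
    ring

section Weight

variable {W : Torus L d → ℝ} {μ : ℝ} {N₀ : Torus L d → ℝ} {c C : ℝ}

lemma integral_energyDensity (hs : IsWeight (weight W μ N₀) c C) (hpos : ∀ x, 0 < N₀ x)
    {f f' : Torus L d → ℝ} {g g' : Fin d → Torus L d → ℝ}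
    (h : ∀ o, MemLp (pair f g o) 2 volume) (h' : ∀ o, MemLp (pair f' g' o) 2 volume) :
    ∫ x, energyDensity W μ N₀ f g f' g' x =
      ⟪wjet (weight W μ N₀) f g, wjet (weight W μ N₀) f' g'⟫ := by
  simp_rw [energyDensity_eq_sum (hpos _)]
  rw [inner_wjet hs h h', integral_finsetSum]
  exact fun o _ => (hs.memLp_mul (h o) o).integrable_mul (hs.memLp_mul (h' o) o)

lemma integral_div_mul (h : ℝ) (u ψ : Torus L d → ℝ) :
    ∫ x, u x / h * ψ x = h⁻¹ * ∫ x, u x * ψ x := by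
  rw [← integral_const_mul]
  congr 1; ext x; ring

/-- The bridge from the equation to the Hilbert space: it becomes `N - N₀ = -h B Φ_N`. -/
lemma solvesDiscrete_iff (hs : IsWeight (weight W μ N₀) c C) (hpos : ∀ x, 0 < N₀ x) {h : ℝ}
    (hh : 0 < h) {N : Torus L d → ℝ} :
    SolvesDiscrete W μ N₀ h N ↔ ∃ g : Fin d → Torus L d → ℝ, HasH1Grad (Phi W μ N) g ∧
      Represents (weight W μ N₀) (-(h • wjet (weight W μ N₀) (Phi W μ N) g))
        fun x => N x - N₀ x := by
  refine exists_congr fun g => and_congr_right fun hg => forall_congr' fun ψ =>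
    forall_congr' fun hψ => ?_
  rw [integral_energyDensity hs hpos hg.memLp_pair (memLp_pair_test hψ),
    integral_div_mul, inner_neg_left, inner_smul_left, inv_mul_eq_iff_eq_mul₀ hh.ne']
  simp only [conj_trivial, mul_neg]

lemma Represents.neg {s : Option (Fin d) → Torus L d → ℝ} {ζ : Jets L d} {u : Torus L d → ℝ}
    (hζ : Represents s ζ u) : Represents s (-ζ) fun x => -u x := by
  intro ψ hψ
  rw [inner_neg_left, ← hζ ψ hψ, ← integral_neg]
  congr 1; ext x; ring

lemma integral_wConv_mul_comm (hW : Continuous W) (heven : ∀ x, W (-x) = W x)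
    {u v : Torus L d → ℝ} (hu : Integrable u) (hv : Integrable v) :
    ∫ x, wConv W u x * v x = ∫ x, wConv W v x * u x := by
  rw [integral_wConv_mul hW hu hv]
  congr 1; ext y; congr 1
  unfold wConv
  congr 1; ext x
  rw [← heven (x - y), neg_sub]

lemma integrable_wConv_mul (hW : Continuous W) {u v : Torus L d → ℝ} (hu : Integrable u)
    (hv : Integrable v) : Integrable fun x => wConv W u x * v x := by
  obtain ⟨K, -, hK⟩ := exists_bound (continuous_wConv hW hu)
  exact hv.bdd_mul (continuous_wConv hW hu).aestronglyMeasurable (ae_of_all _ hK)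

/-! ### Relative entropy and the energy gap. -/

/-- The pointwise relative entropy. -/
def relEntropy (m n : ℝ) : ℝ := m * Real.log m - m * Real.log n - m + n

lemma relEntropy_nonneg {m n : ℝ} (hm : 0 ≤ m) (hn : 0 < n) : 0 ≤ relEntropy m n := by
  unfold relEntropy
  rcases hm.eq_or_lt with rfl | hm
  · simpa using hn.le
  · have h := Real.log_le_sub_one_of_pos (div_pos hn hm)
    rw [Real.log_div hn.ne' hm.ne'] at h
    have h2 := mul_le_mul_of_nonneg_left h hm.le
    rw [mul_sub, mul_sub, mul_div_cancel₀ _ hm.ne'] at h2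
    linarith

lemma eq_of_relEntropy_eq_zero {m n : ℝ} (hm : 0 ≤ m) (hn : 0 < n) (h0 : relEntropy m n = 0) :
    m = n := by
  unfold relEntropy at h0
  rcases hm.eq_or_lt with rfl | hm
  · simp at h0; exact h0.symm
  · by_contra hne
    have h := Real.log_lt_sub_one_of_pos (div_pos hn hm) (by
      rw [Ne, div_eq_one_iff_eq hm.ne']; exact fun h => hne h.symm)
    rw [Real.log_div hn.ne' hm.ne'] at h
    have h2 := mul_lt_mul_of_pos_left h hm
    rw [mul_sub, mul_sub, mul_div_cancel₀ _ hm.ne'] at h2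
    linarith

/-- The real value of the free energy. -/
def freeEnergyReal (W : Torus L d → ℝ) (μ : ℝ) (N : Torus L d → ℝ) : ℝ :=
  (∫ x, (N x * Real.log (N x) - (N x + μ * N x))) + (1 / 2) * ∫ x, ∫ y, W (x - y) * N x * N y

lemma freeEnergyReal_eq (N : Torus L d → ℝ) :
    freeEnergyReal W μ N = (∫ x, (N x * Real.log (N x) - (N x + μ * N x))) +
      (1 / 2) * ∫ x, wConv W N x * N x := by
  unfold freeEnergyReal
  congr 3; ext x
  unfold wConv
  rw [← integral_mul_const]
  congr 1; ext y; ring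

/-- A solution has finite entropy although only `N ∈ L¹` is assumed. Monotonicity of the logarithm
gives `(N₀ - N)(log N - log N₀) ≤ 0`, so `(N₀ - N) Φ_N` is bounded above by an integrable function
and `Represents.integral_mul` makes it integrable. As `N₀ Φ_N` and `N (μ - w_N)` are integrable, so
is `N log N`. -/
lemma integrable_mul_log (hs : IsWeight (weight W μ N₀) c C) (hN₀ : Continuous N₀)
    (hpos : ∀ x, 0 < N₀ x) (hW : Continuous W) {N : Torus L d → ℝ} (hNi : Integrable N)
    (hNpos : ∀ᵐ x, 0 < N x) {ζ : Jets L d} {g : Fin d → Torus L d → ℝ}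
    (hΦ : HasH1Grad (Phi W μ N) g)
    (hrep : Represents (weight W μ N₀) ζ fun x => N x - N₀ x) :
    Integrable fun x => N x * Real.log (N x) := by
  have hN₀i := integrable_of_continuous hN₀
  have hw := continuous_wConv hW hNi
  have hb : Continuous fun x => Real.log (N₀ x) - μ + wConv W N x :=
    ((hN₀.log fun x => (hpos x).ne').sub continuous_const).add hw
  obtain ⟨K, -, hK⟩ := exists_bound hb
  have hR : Integrable fun x => (N₀ x - N x) * (Real.log (N₀ x) - μ + wConv W N x) :=
    (hN₀i.sub hNi).mul_bdd hb.aestronglyMeasurable (ae_of_all _ hK)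
  have hi : Integrable fun x => N₀ x - N x := hN₀i.sub hNi
  have hrep' : Represents (weight W μ N₀) (-ζ) fun x => N₀ x - N x := by
    simpa using hrep.neg
  have h1 := (hrep'.integral_mul hs hi hΦ hR (by
    filter_upwards [hNpos] with x hx
    have : (N₀ x - N x) * (Real.log (N x) - Real.log (N₀ x)) ≤ 0 := by
      rcases le_total (N x) (N₀ x) with h | h
      · exact mul_nonpos_of_nonneg_of_nonpos (by linarith)
          (by linarith [Real.log_le_log hx h])
      · exact mul_nonpos_of_nonpos_of_nonneg (by linarith)
          (by linarith [Real.log_le_log (hpos x) h])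
    unfold Phi
    nlinarith)).1
  obtain ⟨K₀, -, hK₀⟩ := exists_bound hN₀
  have hΦi : Integrable (Phi W μ N) := hΦ.memLp.integrable (by norm_num)
  have h2 : Integrable fun x => N₀ x * Phi W μ N x :=
    hΦi.bdd_mul hN₀.aestronglyMeasurable (ae_of_all _ hK₀)
  have hcw : Continuous fun x => μ - wConv W N x := continuous_const.sub hw
  obtain ⟨K₁, -, hK₁⟩ := exists_bound hcw
  have h3 : Integrable fun x => N x * (μ - wConv W N x) :=
    hNi.mul_bdd hcw.aestronglyMeasurable (ae_of_all _ hK₁)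
  refine ((h2.sub h1).add h3).congr (ae_of_all _ fun x => ?_)
  simp only [Pi.add_apply, Pi.sub_apply, Phi]
  ring

/-- The quantitative minimality of a solution of the discrete equation. -/
lemma energy_gap (hs : IsWeight (weight W μ N₀) c C) (hN₀ : Continuous N₀)
    (hpos : ∀ x, 0 < N₀ x) (hW : IsCk 1 W) (heven : ∀ x, W (-x) = W x) {A : ℝ}
    (hA : ∀ (u : Torus L d → ℝ) (ζ : Jets L d), Integrable u → Represents (weight W μ N₀) ζ u →
      ‖convJet (weight W μ N₀) W u‖ ≤ A * ‖ζ‖) {h : ℝ} (hh : 0 < h) (hsmall : h * A ≤ 1)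
    {N : Torus L d → ℝ} (hNi : Integrable N) (hNpos : ∀ᵐ x, 0 < N x)
    {g : Fin d → Torus L d → ℝ} (hΦ : HasH1Grad (Phi W μ N) g) {X : Jets L d}
    (hX : X = wjet (weight W μ N₀) (Phi W μ N) g)
    (hrep : Represents (weight W μ N₀) (-(h • X)) fun x => N x - N₀ x)
    {M : Torus L d → ℝ} (hM : IsDensity M) (hMlog : Integrable fun x => M x * Real.log (M x))
    {ζ : Jets L d} (hζ : Represents (weight W μ N₀) (-(h • ζ)) fun x => M x - N₀ x) :
    Integrable (fun x => relEntropy (M x) (N x)) ∧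
      h ^ 2 * ‖X‖ ^ 2 / 2 + h * freeEnergyReal W μ N + h * ∫ x, relEntropy (M x) (N x) ≤
        h ^ 2 * ‖ζ‖ ^ 2 / 2 + h * freeEnergyReal W μ M := by
  have hWc := hW.continuous
  have hMi := hM.1
  have hN₀i := integrable_of_continuous hN₀
  have hNlog := integrable_mul_log hs hN₀ hpos hWc hNi hNpos hΦ hrep
  have hu : Integrable fun x => M x - N x := hMi.sub hNi
  have hrepu : Represents (weight W μ N₀) (h • (X - ζ)) fun x => M x - N x := by
    have := Represents.sub (hMi.sub hN₀i) (hNi.sub hN₀i) hζ hrep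
    simp only [Pi.sub_apply, sub_sub_sub_cancel_right] at this
    convert this using 1
    rw [smul_sub]; abel
  have iMN := integrable_wConv_mul hWc hMi hNi
  have iNM := integrable_wConv_mul hWc hNi hMi
  have iMM := integrable_wConv_mul hWc hMi hMi
  have iNN := integrable_wConv_mul hWc hNi hNi
  have iEM : Integrable fun x => M x * Real.log (M x) - (M x + μ * M x) :=
    hMlog.sub (hMi.add (hMi.const_mul μ))
  have iEN : Integrable fun x => N x * Real.log (N x) - (N x + μ * N x) :=
    hNlog.sub (hNi.add (hNi.const_mul μ))
  set R : Torus L d → ℝ := fun x => ((M x * Real.log (M x) - (M x + μ * M x)) -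
    (N x * Real.log (N x) - (N x + μ * N x))) + (wConv W N x * M x - wConv W N x * N x) with hRdef
  have hR : Integrable R := (iEM.sub iEN).add (iNM.sub iNN)
  -- The relative entropy is the Bregman remainder of `t log t`. Its nonnegativity supplies the
  -- upper bound `R` required to pair `M - N` with `Φ_N`, and the pairing in turn shows that the
  -- relative entropy is integrable.
  have hdec (x) : (M x - N x) * Phi W μ N x = R x - relEntropy (M x) (N x) := by
    simp only [hRdef, Phi, relEntropy]; ring
  obtain ⟨hI1, hI2⟩ := hrepu.integral_mul hs hu hΦ hR (by
    filter_upwards [hNpos, hM.2] with x hx hx'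
    rw [hdec]
    linarith [relEntropy_nonneg hx' hx])
  have hIe : Integrable fun x => relEntropy (M x) (N x) := by
    refine (hR.sub hI1).congr (ae_of_all _ fun x => ?_)
    simp only [Pi.sub_apply, hdec]; ring
  refine ⟨hIe, ?_⟩
  have hRint : ∫ x, R x = ((∫ x, (M x * Real.log (M x) - (M x + μ * M x))) -
      ∫ x, (N x * Real.log (N x) - (N x + μ * N x))) +
      ((∫ x, wConv W N x * M x) - ∫ x, wConv W N x * N x) := by
    rw [← integral_sub iEM iEN, ← integral_sub iNM iNN]
    exact integral_add (iEM.sub iEN) (iNM.sub iNN)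
  have hsum : ∫ x, R x = ⟪h • (X - ζ), X⟫ + ∫ x, relEntropy (M x) (N x) := by
    rw [← hX] at hI2
    rw [← hI2, ← integral_add hI1 hIe]
    congr 1; ext x; rw [hdec]; ring
  obtain ⟨K, -, hK⟩ := exists_bound (continuous_wConv hWc hu)
  have hQ := hrepu.integral_mul_bdd hs hu (hasH1Grad_wConv hW hu) hK
  -- The interaction energy of `M - N` has no sign, but the smoothing estimate bounds it by the
  -- squared dual norm of `M - N`.
  have hQle : |∫ x, (M x - N x) * wConv W (fun x => M x - N x) x| ≤
      A * (h ^ 2 * ‖X - ζ‖ ^ 2) := by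
    rw [hQ]
    refine (abs_real_inner_le_norm _ _).trans ?_
    refine (mul_le_mul_of_nonneg_left (hA _ _ hu hrepu) (norm_nonneg _)).trans (le_of_eq ?_)
    rw [norm_smul, Real.norm_of_nonneg hh.le]; ring
  have hQexp : ∫ x, (M x - N x) * wConv W (fun x => M x - N x) x =
      (∫ x, wConv W M x * M x) + (∫ x, wConv W N x * N x) - 2 * ∫ x, wConv W N x * M x := by
    have e1 : ∫ x, (M x - N x) * wConv W (fun x => M x - N x) x =
        ∫ x, ((wConv W M x * M x + wConv W N x * N x) -
          (wConv W N x * M x + wConv W M x * N x)) := by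
      congr 1; ext x
      rw [wConv_sub hWc hMi hNi]; ring
    have e2 := integral_sub (iMM.add iNN) (iNM.add iMN)
    simp only [Pi.add_apply] at e2
    rw [e1, e2, integral_add iMM iNN, integral_add iNM iMN,
      integral_wConv_mul_comm hWc heven hMi hNi]
    ring
  have hF : freeEnergyReal W μ M - freeEnergyReal W μ N =
      h * ⟪X - ζ, X⟫ + (∫ x, relEntropy (M x) (N x)) +
        1 / 2 * ∫ x, (M x - N x) * wConv W (fun x => M x - N x) x := by
    rw [inner_smul_left] at hsum
    simp only [conj_trivial] at hsum
    rw [freeEnergyReal_eq, freeEnergyReal_eq, hQexp]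
    linarith
  have hnorm : ‖X - ζ‖ ^ 2 = ‖X‖ ^ 2 - 2 * ⟪ζ, X⟫ + ‖ζ‖ ^ 2 := by
    rw [norm_sub_sq_real, real_inner_comm]
  have hin : ⟪X - ζ, X⟫ = ‖X‖ ^ 2 - ⟪ζ, X⟫ := by
    rw [inner_sub_left, real_inner_self_eq_norm_sq]
  have h1 := (abs_le.1 hQle).1
  set Q := ∫ x, (M x - N x) * wConv W (fun x => M x - N x) x
  set e := ∫ x, relEntropy (M x) (N x)
  -- The difference of the two sides of the claim is exactly `(h²/2) ‖X - ζ‖² + h Q / 2`. Since `|Q|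
  -- ≤ A h² ‖X - ζ‖²`, the condition `h A ≤ 1` makes it nonnegative.
  have h2 : h * A * (h ^ 2 * ‖X - ζ‖ ^ 2) ≤ 1 * (h ^ 2 * ‖X - ζ‖ ^ 2) :=
    mul_le_mul_of_nonneg_right hsmall (by positivity)
  have h3 := mul_le_mul_of_nonneg_left h1 hh.le
  have h4 : h * freeEnergyReal W μ M = h * freeEnergyReal W μ N +
      h ^ 2 * (‖X‖ ^ 2 - ⟪ζ, X⟫) + h * e + h * Q / 2 := by
    rw [hin] at hF
    linear_combination h * hF
  rw [h4]
  have h5 : h ^ 2 * ‖X - ζ‖ ^ 2 = h ^ 2 * ‖X‖ ^ 2 - 2 * (h ^ 2 * ⟪ζ, X⟫) + h ^ 2 * ‖ζ‖ ^ 2 := by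
    rw [hnorm]; ring
  nlinarith

end Weight

/-! ### Driving fields, time averages and the squared distance. -/

section Weight

variable {W : Torus L d → ℝ} {μ : ℝ} {N₀ : Torus L d → ℝ} {c C : ℝ}

/-- The time average of square-integrable functions on `(0, h) × 𝕋`, with Jensen's inequality. -/
lemma exists_timeAverage {h : ℝ} (hh : 0 < h) {F : ℝ × Torus L d → ℝ}
    (hF : MemLp F 2 ((volume.restrict (Set.Ioo 0 h)).prod volume)) :
    ∃ Z : Lp ℝ 2 (volume : Measure (Torus L d)),
      (∀ f : Torus L d → ℝ, MemLp f 2 volume → h * ∫ x, Z x * f x =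
        ∫ p, F p * f p.2 ∂((volume.restrict (Set.Ioo 0 h)).prod volume)) ∧
      h * ‖Z‖ ^ 2 ≤ ∫ p, F p * F p ∂((volume.restrict (Set.Ioo 0 h)).prod volume) := by
  set ρ : Measure ℝ := volume.restrict (Set.Ioo 0 h) with hρ
  set a : ENNReal := (ENNReal.ofReal h)⁻¹ with ha
  have ha_top : a ≠ ⊤ := ENNReal.inv_ne_top.2 (ENNReal.ofReal_pos.2 hh).ne'
  have ha_real : a.toReal = h⁻¹ := by
    rw [ha, ENNReal.toReal_inv, ENNReal.toReal_ofReal hh.le]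
  have hprob : IsProbabilityMeasure (a • ρ) := by
    refine ⟨?_⟩
    rw [Measure.smul_apply, hρ, Measure.restrict_apply_univ, Real.volume_Ioo, sub_zero, smul_eq_mul]
    exact ENNReal.inv_mul_cancel (ENNReal.ofReal_pos.2 hh).ne' ENNReal.ofReal_ne_top
  have hprod : (a • ρ).prod (volume : Measure (Torus L d)) = a • ρ.prod volume :=
    Measure.prod_smul_left a
  have hF' : MemLp F 2 ((a • ρ).prod volume) := by
    rw [hprod]; exact hF.smul_measure ha_top
  have hsnd : MeasurePreserving Prod.snd ((a • ρ).prod (volume : Measure (Torus L d))) volume :=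
    measurePreserving_snd
  -- For normalized time, functions independent of time embed isometrically by `f ↦ f ∘ Prod.snd`.
  -- Time averaging is the adjoint of this embedding, so Jensen's inequality is the statement that
  -- the adjoint has norm at most one.
  set j := (Lp.compMeasurePreservingₗᵢ ℝ (E := ℝ) (p := 2) Prod.snd hsnd).toContinuousLinearMap
  have hjnorm : ‖j‖ ≤ 1 := LinearIsometry.norm_toContinuousLinearMap_le _
  have hint (G : ℝ × Torus L d → ℝ) :
      h * ∫ p, G p ∂((a • ρ).prod volume) = ∫ p, G p ∂(ρ.prod volume) := by
    rw [hprod, integral_smul_measure, ha_real, smul_eq_mul, mul_inv_cancel_left₀ hh.ne']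
  refine ⟨ContinuousLinearMap.adjoint j hF'.toLp, fun f hf => ?_, ?_⟩
  · rw [← hint]
    congr 1
    have h1 : ∫ x, ContinuousLinearMap.adjoint j hF'.toLp x * f x =
        ⟪ContinuousLinearMap.adjoint j hF'.toLp, hf.toLp⟫ := by
      rw [L2.inner_def]
      refine integral_congr_ae ?_
      filter_upwards [hf.coeFn_toLp] with x hx
      rw [hx]; simp [mul_comm]
    rw [h1, ContinuousLinearMap.adjoint_inner_left, L2.inner_def]
    refine integral_congr_ae ?_
    have h2 : j hf.toLp =ᵐ[(a • ρ).prod volume] (hf.toLp : Torus L d → ℝ) ∘ Prod.snd :=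
      Lp.coeFn_compMeasurePreserving _ hsnd
    have h3 := hsnd.quasiMeasurePreserving.ae hf.coeFn_toLp
    filter_upwards [hF'.coeFn_toLp, h2, h3] with p h4 h5 h6
    rw [h4, h5, Function.comp, h6]; simp [mul_comm]
  · rw [← hint]
    refine mul_le_mul_of_nonneg_left ?_ hh.le
    have h1 : ‖ContinuousLinearMap.adjoint j hF'.toLp‖ ≤ ‖hF'.toLp‖ := by
      refine (ContinuousLinearMap.le_opNorm _ _).trans ?_
      rw [LinearIsometryEquiv.norm_map]
      exact mul_le_of_le_one_left (norm_nonneg _) hjnorm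
    refine (pow_le_pow_left₀ (norm_nonneg _) h1 2).trans (le_of_eq ?_)
    rw [← real_inner_self_eq_norm_sq, L2.inner_def]
    refine integral_congr_ae ?_
    filter_upwards [hF'.coeFn_toLp] with p h4
    rw [h4]; simp [sq]

lemma IsWeight.memLp_mul_snd {s : Option (Fin d) → Torus L d → ℝ} (hs : IsWeight s c C)
    {ρ : Measure ℝ} [SFinite ρ] {F : ℝ × Torus L d → ℝ} (hF : MemLp F 2 (ρ.prod volume))
    (o : Option (Fin d)) : MemLp (fun p => s o p.2 * F p) 2 (ρ.prod volume) :=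
  (hF.const_mul C).mono (((hs.measurable o).comp measurable_snd).aestronglyMeasurable.mul hF.1)
    (ae_of_all _ fun p => by
      rw [norm_mul, norm_mul]
      exact mul_le_mul_of_nonneg_right ((hs.abs_le o p.2).trans (le_abs_self C)) (norm_nonneg _))

/-- A driving field can be replaced by its time average, at no greater cost. -/
lemma Drives.exists_represents (hs : IsWeight (weight W μ N₀) c C) (hpos : ∀ x, 0 < N₀ x) {h : ℝ}
    (hh : 0 < h) {N : Torus L d → ℝ} {φ : ℝ → Torus L d → ℝ} {g : ℝ → Fin d → Torus L d → ℝ}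
    (hd : Drives W μ N₀ h N φ g) :
    ∃ ζ : Jets L d, Represents (weight W μ N₀) (-(h • ζ)) (fun x => N x - N₀ x) ∧
      ENNReal.ofReal (h ^ 2 * ‖ζ‖ ^ 2) ≤ ENNReal.ofReal h * ∫⁻ t in Set.Ioo 0 h, ∫⁻ x,
        ENNReal.ofReal (energyDensity W μ N₀ (φ t) (g t) (φ t) (g t) x) := by
  set s := weight W μ N₀ with hsdef
  set ρ : Measure ℝ := volume.restrict (Set.Ioo 0 h) with hρ
  have hm (o : Option (Fin d)) :
      MemLp (fun p : ℝ × Torus L d => pair (φ p.1) (g p.1) o p.2) 2 (ρ.prod volume) := by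
    cases o with
    | none => exact hd.memLp
    | some i => exact hd.memLp_grad i
  have hsm (o : Option (Fin d)) :
      MemLp (fun p : ℝ × Torus L d => s o p.2 * pair (φ p.1) (g p.1) o p.2) 2 (ρ.prod volume) :=
    hs.memLp_mul_snd (hm o) o
  -- The weights do not depend on time, so each weighted component is averaged separately. Whether
  -- the average is again the jet of an `H^1` function is never needed: `Represents` and
  -- `energy_gap` accept an arbitrary jet.
  choose Z hZ hZnorm using fun o => exists_timeAverage hh (hsm o)
  refine ⟨WithLp.toLp 2 Z, fun ψ hψ => ?_, ?_⟩
  · have hψm := memLp_pair_test hψ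
    rw [hd.arrives ψ hψ, inner_neg_left, inner_smul_left, wjet,
      inner_toJet _ fun o => hs.memLp_mul (hψm o) o, Finset.mul_sum]
    simp only [conj_trivial]
    congr 1
    have hprodI (o : Option (Fin d)) : Integrable (fun p : ℝ × Torus L d =>
        s o p.2 * pair (φ p.1) (g p.1) o p.2 *
          (s o p.2 * pair ψ (fun i => pderiv i ψ) o p.2)) (ρ.prod volume) := by
      have h2 : MemLp (fun p : ℝ × Torus L d => s o p.2 * pair ψ (fun i => pderiv i ψ) o p.2) 2
          (ρ.prod volume) := (hs.memLp_mul (hψm o) o).comp_snd ρ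
      exact (hsm o).integrable_mul h2
    have e1 : ∀ o, h * ∫ x, Z o x * (s o x * pair ψ (fun i => pderiv i ψ) o x) =
        ∫ p, s o p.2 * pair (φ p.1) (g p.1) o p.2 *
          (s o p.2 * pair ψ (fun i => pderiv i ψ) o p.2) ∂(ρ.prod volume) :=
      fun o => hZ o _ (hs.memLp_mul (hψm o) o)
    refine Eq.trans ?_ (Finset.sum_congr rfl fun o _ => (e1 o).symm)
    rw [← integral_finsetSum _ fun o _ => hprodI o,
      integral_prod _ (integrable_finsetSum _ fun o _ => hprodI o)]
    congr 1; ext t; congr 1; ext x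
    rw [energyDensity_eq_sum (hpos x)]
  · have hsq (o : Option (Fin d)) : Integrable (fun p : ℝ × Torus L d =>
        s o p.2 * pair (φ p.1) (g p.1) o p.2 * (s o p.2 * pair (φ p.1) (g p.1) o p.2))
          (ρ.prod volume) := (hsm o).integrable_mul (hsm o)
    have hsum : Integrable (fun p : ℝ × Torus L d =>
        energyDensity W μ N₀ (φ p.1) (g p.1) (φ p.1) (g p.1) p.2) (ρ.prod volume) := by
      refine (integrable_finsetSum Finset.univ fun o _ => hsq o).congr (ae_of_all _ fun p => ?_)
      exact (energyDensity_eq_sum (hpos p.2) _ _ _ _).symm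
    have hnn (p : ℝ × Torus L d) :
        0 ≤ energyDensity W μ N₀ (φ p.1) (g p.1) (φ p.1) (g p.1) p.2 := by
      rw [energyDensity_eq_sum (hpos p.2)]
      exact Finset.sum_nonneg fun o _ => mul_self_nonneg _
    have e1 : ∫⁻ t in Set.Ioo 0 h, ∫⁻ x,
        ENNReal.ofReal (energyDensity W μ N₀ (φ t) (g t) (φ t) (g t) x) =
        ENNReal.ofReal (∫ p : ℝ × Torus L d,
          energyDensity W μ N₀ (φ p.1) (g p.1) (φ p.1) (g p.1) p.2 ∂(ρ.prod volume)) := by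
      rw [ofReal_integral_eq_lintegral_ofReal hsum (ae_of_all _ hnn),
        lintegral_prod _ hsum.1.aemeasurable.ennreal_ofReal]
    rw [e1, ← ENNReal.ofReal_mul hh.le]
    refine ENNReal.ofReal_le_ofReal ?_
    rw [sq h, mul_assoc]
    refine mul_le_mul_of_nonneg_left ?_ hh.le
    have e2 : ∫ p : ℝ × Torus L d,
        energyDensity W μ N₀ (φ p.1) (g p.1) (φ p.1) (g p.1) p.2 ∂(ρ.prod volume) =
        ∑ o, ∫ p : ℝ × Torus L d, s o p.2 * pair (φ p.1) (g p.1) o p.2 *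
          (s o p.2 * pair (φ p.1) (g p.1) o p.2) ∂(ρ.prod volume) := by
      rw [← integral_finsetSum _ fun o _ => hsq o]
      congr 1; ext p
      rw [energyDensity_eq_sum (hpos p.2)]
    rw [e2, PiLp.norm_sq_eq_of_L2, Finset.mul_sum]
    exact Finset.sum_le_sum fun o _ => hZnorm o

/-- The field constant in time is admissible, and its cost is `h · h · ‖·‖²`. -/
lemma distASq_le (hs : IsWeight (weight W μ N₀) c C) (hpos : ∀ x, 0 < N₀ x) {h : ℝ} (hh : 0 < h)
    {N f : Torus L d → ℝ} {g : Fin d → Torus L d → ℝ} (hf : HasH1Grad f g)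
    (hrep : Represents (weight W μ N₀) (-(h • wjet (weight W μ N₀) f g)) fun x => N x - N₀ x) :
    distASq W μ N₀ h N ≤ ENNReal.ofReal (h ^ 2 * ‖wjet (weight W μ N₀) f g‖ ^ 2) := by
  have hd : Drives W μ N₀ h N (fun _ => f) (fun _ => g) := by
    refine ⟨hf.memLp.comp_snd _, fun i => (hf.memLp_grad i).comp_snd _, ae_of_all _ fun _ => hf,
      fun ψ hψ => ?_⟩
    rw [hrep ψ hψ, integral_energyDensity hs hpos hf.memLp_pair (memLp_pair_test hψ),
      setIntegral_const, inner_neg_left, inner_smul_left]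
    simp [hh.le]
  have hinf : distASq W μ N₀ h N ≤ ENNReal.ofReal h * ∫⁻ _ in Set.Ioo 0 h, ∫⁻ x,
      ENNReal.ofReal (energyDensity W μ N₀ f g f g x) :=
    iInf_le_of_le (fun _ => f) (iInf_le_of_le (fun _ => g) (iInf_le _ hd))
  refine hinf.trans (le_of_eq ?_)
  have hsq (o : Option (Fin d)) : Integrable (fun x => weight W μ N₀ o x * pair f g o x *
      (weight W μ N₀ o x * pair f g o x)) volume :=
    (hs.memLp_mul (hf.memLp_pair o) o).integrable_mul (hs.memLp_mul (hf.memLp_pair o) o)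
  have hI : Integrable (energyDensity W μ N₀ f g f g) := by
    refine (integrable_finsetSum Finset.univ fun o _ => hsq o).congr (ae_of_all _ fun x => ?_)
    exact (energyDensity_eq_sum (hpos x) _ _ _ _).symm
  have hnn (x) : 0 ≤ energyDensity W μ N₀ f g f g x := by
    rw [energyDensity_eq_sum (hpos x)]
    exact Finset.sum_nonneg fun o _ => mul_self_nonneg _
  rw [← ofReal_integral_eq_lintegral_ofReal hI (ae_of_all _ hnn), lintegral_const,
    integral_energyDensity hs hpos hf.memLp_pair hf.memLp_pair, real_inner_self_eq_norm_sq,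
    Measure.restrict_apply_univ, Real.volume_Ioo, sub_zero, ← ENNReal.ofReal_mul (by positivity),
    ← ENNReal.ofReal_mul hh.le]
  congr 1; ring

lemma freeEnergy_eq_coe {N : Torus L d → ℝ} (hN : Integrable fun x => N x * Real.log (N x)) :
    freeEnergy W μ N = (freeEnergyReal W μ N : EReal) := by
  rw [freeEnergy, if_pos hN]; rfl

lemma jkoFunctional_le {h : ℝ} {N : Torus L d → ℝ}
    (hN : Integrable fun x => N x * Real.log (N x)) {a : ℝ} (ha : 0 ≤ a)
    (hdist : distASq W μ N₀ h N ≤ ENNReal.ofReal a) :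
    jkoFunctional W μ N₀ h N ≤ ((a / 2 + h * freeEnergyReal W μ N : ℝ) : EReal) := by
  rw [jkoFunctional, freeEnergy_eq_coe hN, EReal.coe_add, EReal.coe_mul]
  refine add_le_add_left ?_ _
  have h1 : distASq W μ N₀ h N / 2 ≤ ENNReal.ofReal (a / 2) := by
    rw [ENNReal.ofReal_div_of_pos two_pos, ENNReal.ofReal_ofNat]
    exact ENNReal.div_le_div_right hdist 2
  refine (EReal.coe_ennreal_le_coe_ennreal_iff.2 h1).trans (le_of_eq ?_)
  rw [EReal.coe_ennreal_ofReal, max_eq_left (by positivity)]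

lemma le_jkoFunctional {h : ℝ} {N : Torus L d → ℝ}
    (hN : Integrable fun x => N x * Real.log (N x)) {a : ℝ}
    (hdist : ENNReal.ofReal a ≤ distASq W μ N₀ h N) :
    ((a / 2 + h * freeEnergyReal W μ N : ℝ) : EReal) ≤ jkoFunctional W μ N₀ h N := by
  rw [jkoFunctional, freeEnergy_eq_coe hN, EReal.coe_add, EReal.coe_mul]
  refine add_le_add_left ?_ _
  have h1 : ENNReal.ofReal (a / 2) ≤ distASq W μ N₀ h N / 2 := by
    rw [ENNReal.ofReal_div_of_pos two_pos, ENNReal.ofReal_ofNat]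
    exact ENNReal.div_le_div_right hdist 2
  refine le_trans ?_ (EReal.coe_ennreal_le_coe_ennreal_iff.2 h1)
  rw [EReal.coe_ennreal_ofReal]
  exact EReal.coe_le_coe_iff.2 (le_max_left _ _)

lemma jkoFunctional_eq_top {h : ℝ} (hh : 0 < h) {N : Torus L d → ℝ}
    (hN : ¬ Integrable fun x => N x * Real.log (N x)) : jkoFunctional W μ N₀ h N = ⊤ := by
  rw [jkoFunctional, freeEnergy, if_neg hN, EReal.coe_mul_top_of_pos hh]
  exact EReal.add_top_of_ne_bot (EReal.coe_ennreal_ne_bot _)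

/-! ### Solutions are minimizers, and solutions exist. -/

/-- Every solution of the discrete equation is the unique minimizer. -/
lemma IsSolution.isJKOMinimizer (hs : IsWeight (weight W μ N₀) c C) (hN₀ : Continuous N₀)
    (hpos : ∀ x, 0 < N₀ x) (hW : IsCk 1 W) (heven : ∀ x, W (-x) = W x) {A : ℝ}
    (hA : ∀ (u : Torus L d → ℝ) (ζ : Jets L d), Integrable u → Represents (weight W μ N₀) ζ u →
      ‖convJet (weight W μ N₀) W u‖ ≤ A * ‖ζ‖) {h : ℝ} (hh : 0 < h) (hsmall : h * A ≤ 1)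
    {N : Torus L d → ℝ} (hN : IsSolution W μ N₀ h N) :
    IsJKOMinimizer W μ N₀ h N ∧
      ∀ M : Torus L d → ℝ, IsJKOMinimizer W μ N₀ h M → M =ᵐ[volume] N := by
  obtain ⟨g, hΦ, hrep⟩ := (solvesDiscrete_iff hs hpos hh).1 hN.eqn
  have hdens : IsDensity N := ⟨hN.integrable, hN.pos.mono fun x hx => hx.le⟩
  have hNlog := integrable_mul_log hs hN₀ hpos hW.continuous hN.integrable hN.pos hΦ hrep
  set X := wjet (weight W μ N₀) (Phi W μ N) g with hX
  have hle := jkoFunctional_le hNlog (by positivity) (distASq_le hs hpos hh hΦ hrep)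
  set J : ℝ := h ^ 2 * ‖X‖ ^ 2 / 2 + h * freeEnergyReal W μ N with hJ
  have hgap {M : Torus L d → ℝ} (hM : IsDensity M)
      (hMlog : Integrable fun x => M x * Real.log (M x)) :
      ((J + h * ∫ x, relEntropy (M x) (N x) : ℝ) : EReal) ≤ jkoFunctional W μ N₀ h M := by
    -- The energy gap is solved for the cost and holds for every driving field, hence for the
    -- infimum. The real number may be negative, in which case `ENNReal.ofReal` makes the bound
    -- trivial.
    have hd : ENNReal.ofReal (2 * (J + h * (∫ x, relEntropy (M x) (N x)) -
        h * freeEnergyReal W μ M)) ≤ distASq W μ N₀ h M := by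
      refine le_iInf fun φ => le_iInf fun k => le_iInf fun hdr => ?_
      obtain ⟨ζ, hζ, hcost⟩ := hdr.exists_represents hs hpos hh
      refine le_trans (ENNReal.ofReal_le_ofReal ?_) hcost
      have := (energy_gap hs hN₀ hpos hW heven hA hh hsmall hN.integrable hN.pos hΦ hX hrep hM
        hMlog hζ).2
      linarith
    refine le_trans (le_of_eq ?_) (le_jkoFunctional hMlog hd)
    congr 1; ring
  have hent {M : Torus L d → ℝ} (hM : IsDensity M) : ∀ᵐ x, 0 ≤ relEntropy (M x) (N x) := by
    filter_upwards [hN.pos, hM.2] with x h1 h2 using relEntropy_nonneg h2 h1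
  refine ⟨⟨hdens, fun M hM => hle.trans ?_⟩, fun M hMmin => ?_⟩
  · by_cases hMlog : Integrable fun x => M x * Real.log (M x)
    · refine le_trans (EReal.coe_le_coe_iff.2 ?_) (hgap hM hMlog)
      have := mul_nonneg hh.le (integral_nonneg_of_ae (hent hM))
      linarith
    · rw [jkoFunctional_eq_top hh hMlog]; exact le_top
  · have hM := hMmin.1
    have hMle := (hMmin.2 N hdens).trans hle
    have hMlog : Integrable fun x => M x * Real.log (M x) := by
      by_contra hcon
      rw [jkoFunctional_eq_top hh hcon] at hMle
      exact EReal.coe_ne_top _ (top_le_iff.1 hMle)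
    have h1 := EReal.coe_le_coe_iff.1 ((hgap hM hMlog).trans hMle)
    have h2 : ∫ x, relEntropy (M x) (N x) = 0 := by
      refine le_antisymm ?_ (integral_nonneg_of_ae (hent hM))
      by_contra hcon
      have := mul_pos hh (not_le.1 hcon)
      linarith
    -- A vanishing Bochner integral is informative only for an integrable function. Integrability
    -- comes from `energy_gap`, which needs a driving field towards `M`; without one the functional
    -- would be `⊤` at the minimizer `M`.
    have hnlogM : Integrable fun x => relEntropy (M x) (N x) := by
      by_cases hdist : ∃ φ k, Drives W μ N₀ h M φ k
      · obtain ⟨φ, k, hdr⟩ := hdist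
        obtain ⟨ζ, hζ, -⟩ := hdr.exists_represents hs hpos hh
        exact (energy_gap hs hN₀ hpos hW heven hA hh hsmall hN.integrable hN.pos hΦ hX hrep hM
          hMlog hζ).1
      · exfalso
        have htop : distASq W μ N₀ h M = ⊤ := by
          refine top_le_iff.1 (le_iInf fun φ => le_iInf fun k => le_iInf fun hdr => ?_)
          exact absurd ⟨φ, k, hdr⟩ hdist
        rw [jkoFunctional, htop, freeEnergy_eq_coe hMlog, ENNReal.top_div_of_ne_top (by norm_num),
          ← EReal.coe_mul, EReal.coe_ennreal_top, EReal.top_add_coe] at hMle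
        exact EReal.coe_ne_top _ (top_le_iff.1 hMle)
    have h3 := (integral_eq_zero_iff_of_nonneg_ae (hent hM) hnlogM).1 h2
    filter_upwards [h3, hN.pos, hM.2] with x h4 h5 h6
    exact eq_of_relEntropy_eq_zero h6 h5 h4

lemma exists_isSolution (hs : IsWeight (weight W μ N₀) c C) (hN₀ : Continuous N₀)
    (hpos : ∀ x, 0 < N₀ x) (hW : IsCk 2 W) {A : ℝ} (hA0 : 0 ≤ A)
    (hA : ∀ (u : Torus L d → ℝ) (ζ : Jets L d), Integrable u → Represents (weight W μ N₀) ζ u →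
      ‖convJet (weight W μ N₀) W u‖ ≤ A * ‖ζ‖) {h : ℝ} (hh : 0 < h) (hsmall : 6 * h * A ≤ 1) :
    ∃ N, IsSolution W μ N₀ h N := by
  obtain ⟨φ, g, hφ, hexp, hrep⟩ := exists_represents hs hW μ hN₀ hA0 hA hh hsmall
  set N : Torus L d → ℝ := fun x => Real.exp (φ x) with hN
  have hlog : (fun x => Real.log (N x)) = φ := by ext x; simp [hN]
  have hΦ : Phi W μ N = fun x => φ x + -μ + wConv W N x := by
    ext x; simp [Phi, hN, sub_eq_add_neg]
  refine ⟨N, hexp, ae_of_all _ fun x => Real.exp_pos _, ⟨g, hlog ▸ hφ⟩,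
    (solvesDiscrete_iff hs hpos hh).2 ⟨_, ?_, hΦ ▸ hrep⟩⟩
  rw [hΦ]
  exact (hφ.add (hasH1Grad_const _)).add (hasH1Grad_wConv (hW.of_le one_le_two) hexp)

end Weight

end GrandCanonical

end

theorem mainTheorem9 (L : ℝ) [Fact (0 < L)] (d : ℕ)
    (W : GrandCanonical.Torus L d → ℝ) (hW : GrandCanonical.IsCk 2 W)
    (hWeven : ∀ x, W (-x) = W x) (μ : ℝ)
    (N₀ : GrandCanonical.Torus L d → ℝ) (hN₀ : GrandCanonical.IsCk 1 N₀)
    (hN₀_below : ∃ κ : ℝ, 0 < κ ∧ ∀ x, κ ≤ N₀ x) :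
    ∃ h₀ : ℝ, 0 < h₀ ∧ ∀ h : ℝ, 0 < h → h < h₀ →
      ∃ N : GrandCanonical.Torus L d → ℝ,
        GrandCanonical.IsSolution W μ N₀ h N ∧
        (∀ N' : GrandCanonical.Torus L d → ℝ,
          GrandCanonical.IsSolution W μ N₀ h N' → N' =ᵐ[MeasureTheory.volume] N) ∧
        GrandCanonical.IsJKOMinimizer W μ N₀ h N ∧
        (∀ M : GrandCanonical.Torus L d → ℝ,
          GrandCanonical.IsJKOMinimizer W μ N₀ h M → M =ᵐ[MeasureTheory.volume] N) := by
  obtain ⟨κ, hκ, hle⟩ := hN₀_below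
  have hpos (x) : 0 < N₀ x := hκ.trans_le (hle x)
  obtain ⟨c, C, hs⟩ := GrandCanonical.exists_isWeight hW.continuous μ hN₀.continuous hκ hle
  obtain ⟨A, hA0, hA⟩ := GrandCanonical.norm_convJet_le hs hW
  -- This gives both `6 h A ≤ 1`, for the contraction, and `h A ≤ 1`, for the energy gap; `A + 1`
  -- avoids dividing by zero. The constant `A` is obtained from the weights and `W` before `h` is
  -- chosen.
  refine ⟨1 / (6 * (A + 1)), by positivity, fun h hh hlt => ?_⟩
  rw [lt_div_iff₀ (by positivity)] at hlt
  have hhA : 0 ≤ h * A := mul_nonneg hh.le hA0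
  obtain ⟨N, hN⟩ := GrandCanonical.exists_isSolution hs hN₀.continuous hpos hW hA0 hA hh
    (by linarith)
  have hmin {N'} (hN' : GrandCanonical.IsSolution W μ N₀ h N') :=
    hN'.isJKOMinimizer hs hN₀.continuous hpos (hW.of_le one_le_two) hWeven hA hh (by linarith)
  -- Any other solution is itself a minimizer and therefore coincides with the unique minimizer `N`.
  exact ⟨N, hN, fun N' hN' => (hmin hN).2 N' (hmin hN').1, hmin hN⟩
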